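/- **Model.** Machine words have $\log_2 u$ bits; internal memory has $m\ge 1$ words; the disk is an infinite sequence of blocks of $b$ words each. A word may hold an item, identified with its hash value in $U=\{0,\dots,u-1\}$, or auxiliary data. One I/O accesses one block: it reads the block and may overwrite it immediately (so a block read, a block write, and a read followed at once by a write of the same block each cost 1). Computation in memory is free; between operations, all that is known besides the disk is the content of the $m$ memory words (and, for a randomized table, its random choices). Items are indivisible: an item gets into a block or stays in memory only as a copy of an item at hand (in memory, newly inserted, or in a block read), and a query for an inserted item that is not in memory must visit a block containing the item. A query knows only the memory content, the queried item, and the blocks it has read (and the random choices). **Theorem.** Let $c>0$, $K>0$ and $\varepsilon>0$ be constants. There are constants $C>0$ and $b_0$, depending only on $c,K,\varepsilon$, such that the following holds for all $b\ge b_0$, $m\ge 1$, and all $u,n$ with $b>\log_2 u$, $u>n^3$ and $n\ge \varepsilon\, m\, b^{1+2c}$. Consider any dynamic hash table (deterministic or randomized) in this model, and insert $n$ independent, uniformly random items of $U$ into it, starting with the empty table. Suppose that the expected total cost of the insertions is at most $n\cdot t_u$ I/Os, and that for every $k=1,\dots,n$, when $k$ items have been inserted, the expected average cost of a successful query (the average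 is over the $k$ inserted items) is at most $t_q$ I/Os, where $$t_q\le 1+\frac{K}{b^{c}} .$$ Then: 1. if $c>1$, then $t_u\ge 1-C/b^{(c-1)/4}$; 2. if $c=1$, then $t_u\ge C$; 3. if $0<c<1$, then $t_u\ge C\,b^{c-1}$. -/

import Mathlib

open MeasureTheory
open scoped NNReal ENNReal BigOperators

namespace ExternalHash

/-- A machine word. It either holds an (atomic) item, identified with its hash value in
`{0, …, u - 1}`, or `log u` bits of arbitrary auxiliary data. -/
inductive Word (u : ℕ) : Type
  | item (x : Fin u) : Word u
  | data (d : Fin u) : Word u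

/-- The contents of the internal memory: `m` words. -/
abbrev Memory (u m : ℕ) : Type := Fin m → Word u

/-- The contents of a disk block: `b` words. -/
abbrev Block (u b : ℕ) : Type := Fin b → Word u

/-- The contents of the (infinite) disk; blocks are addressed by natural numbers. -/
abbrev Disk (u b : ℕ) : Type := ℕ → Block u b

/-- The set of items held in an array of words. -/
def items {u k : ℕ} (w : Fin k → Word u) : Set (Fin u) := {x | ∃ i, w i = Word.item x}

/-- The actions of an insertion, from the moment when the new item arrives. `access a w k` is one
I/O on block `a`: the contents `B` of the block are read, the block is overwritten by `w B`, and
the insertion proceeds with `k B`. (A pure read has `w B = B`; a pure write has `w` and `k`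
constant.) `halt M` ends the insertion and leaves the memory with contents `M`. The computation
between two I/Os is free and arbitrary, and may depend on everything seen since the insertion
started. -/
inductive InsertProc (u m b : ℕ) : Type
  | halt (M : Memory u m) : InsertProc u m b
  | access (a : ℕ) (w : Block u b → Block u b) (k : Block u b → InsertProc u m b) :
      InsertProc u m b

namespace InsertProc

variable {u m b : ℕ}

/-- Indivisibility. `A` is the set of items at hand (those in memory, the new item, and those in
the blocks read so far): items are written to disk or kept in memory only as copies of items at
hand. -/
def Indivisible : InsertProc u m b → Set (Fin u) → Prop
  | halt M, A => items M ⊆ A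
  | access _ w k, A => ∀ B : Block u b,
      items (w B) ⊆ A ∪ items B ∧ (k B).Indivisible (A ∪ items B)

/-- The contents of memory and disk when the insertion has been executed on the disk `D`. -/
def result : InsertProc u m b → Disk u b → Memory u m × Disk u b
  | halt M, D => (M, D)
  | access a w k, D => (k (D a)).result (Function.update D a (w (D a)))

/-- The number of I/Os made by the insertion when it is executed on the disk `D`. -/
def cost : InsertProc u m b → Disk u b → ℕ
  | halt _, _ => 0
  | access a w k, D => (k (D a)).cost (Function.update D a (w (D a))) + 1

end InsertProc

/-- The actions of a query: `read a k` is one I/O that reads block `a`, finds contents `B`, and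
proceeds with `k B`. -/
inductive QueryProc (u b : ℕ) : Type
  | halt : QueryProc u b
  | read (a : ℕ) (k : Block u b → QueryProc u b) : QueryProc u b

namespace QueryProc

variable {u b : ℕ}

/-- The number of I/Os made by the query on the disk `D`. -/
def cost : QueryProc u b → Disk u b → ℕ
  | halt, _ => 0
  | read a k, D => (k (D a)).cost D + 1

/-- The query, executed on the disk `D`, visits a block that contains the item `x`. -/
def Visits : QueryProc u b → Disk u b → Fin u → Prop
  | halt, _, _ => False
  | read a k, D, x => x ∈ items (D a) ∨ (k (D a)).Visits D x

end QueryProc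

/-- A deterministic dynamic hash table in external memory, with `m` words of memory, blocks of `b`
words and words of `log u` bits, in the indivisibility model. Between operations everything that is
known, other than the disk, is stored in the `m` words of memory. -/
structure HashTable (u m b : ℕ) where
  /-- The initial contents of the memory. -/
  mem₀ : Memory u m
  /-- The initial contents of the disk. -/
  disk₀ : Disk u b
  /-- The table is initially empty. -/
  mem₀_empty : items mem₀ = ∅
  disk₀_empty : ∀ a, items (disk₀ a) = ∅
  /-- The insertion algorithm, started with given memory contents and a new item. -/
  insert : Memory u m → Fin u → InsertProc u m b
  insert_indivisible : ∀ M x, (insert M x).Indivisible (items M ∪ {x})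
  /-- The query algorithm, started with given memory contents and a queried item. -/
  query : Memory u m → Fin u → QueryProc u b

namespace HashTable

variable {u m b n : ℕ}

/-- The contents of memory and disk when the first `k` items of the sequence `x` have been
inserted. -/
def snapshot (T : HashTable u m b) (x : Fin n → Fin u) : ℕ → Memory u m × Disk u b
  | 0 => (T.mem₀, T.disk₀)
  | k + 1 =>
    if h : k < n then
      (T.insert (T.snapshot x k).1 (x ⟨k, h⟩)).result (T.snapshot x k).2
    else T.snapshot x k

/-- The total number of I/Os made by the insertions of the items of the sequence `x`. -/
def insertionCost (T : HashTable u m b) (x : Fin n → Fin u) : ℕ :=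
  ∑ i : Fin n, (T.insert (T.snapshot x i).1 (x i)).cost (T.snapshot x i).2

/-- The number of I/Os made by a query for the item `y` when the first `k` items of the sequence
`x` have been inserted. -/
def queryCost (T : HashTable u m b) (x : Fin n → Fin u) (k : ℕ) (y : Fin u) : ℕ :=
  (T.query (T.snapshot x k).1 y).cost (T.snapshot x k).2

/-- At any time during `n` insertions, each item inserted so far is in memory, or the query for it
visits a block that contains it. -/
def AnswersQueries (T : HashTable u m b) (n : ℕ) : Prop :=
  ∀ (x : Fin n → Fin u) (k : ℕ) (j : Fin n), k ≤ n → (j : ℕ) < k →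
    x j ∈ items (T.snapshot x k).1 ∨
      (T.query (T.snapshot x k).1 (x j)).Visits (T.snapshot x k).2 (x j)

/-- The expected total number of I/Os of the insertions of `n` items that are independent and
uniformly distributed in `{0, …, u - 1}`. -/
noncomputable def meanInsertionCost (T : HashTable u m b) (n : ℕ) : ℝ≥0 :=
  𝔼 x : Fin n → Fin u, (T.insertionCost x : ℝ≥0)

/-- The expected average number of I/Os of a successful query when the first `k` of `n` independent
and uniformly distributed items have been inserted. The expectation is over the items, the average
over the uniform choice of the queried one among the `k` inserted items. -/
noncomputable def meanQueryCost (T : HashTable u m b) (n k : ℕ) : ℝ≥0 :=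
  𝔼 x : Fin n → Fin u,
    𝔼 j ∈ Finset.univ.filter (fun j : Fin n => (j : ℕ) < k), (T.queryCost x k (x j) : ℝ≥0)

end HashTable

end ExternalHash

/-! For fixed memory contents `M`, the first block read by a query is a function `address M` of the
item alone. A query whose first read misses costs at least two I/Os, so query cost 1 + δ leaves in
expectation at most kδ + 5m slow items and repeats after k insertions (`expect_slow_le`).

Call a block heavy if more than a fraction ρ of `U` is sent to it. If the items sent to heavy
blocks, or nowhere, have density at least φ, then typically a proportion of order φ of the inserted
items is of this kind, while the at most 1/ρ heavy blocks hold at most b/ρ items: many items are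
slow (`card_overloaded_le`). If the density is at most φ, a group of s insertions is sent mostly to
distinct blocks. A new item stored at its address at the end of a window of insertions was not on
disk when the window began, so its block was accessed meanwhile; the window costs almost s I/Os
(`window_card_le`). Slow items escape this count. A window therefore consists of g groups, which may
share I/Os, and each slow item is charged only 1/g.

Both alternatives fit into one inequality, linear in the costs, with weight κ on slow items
(`window_cost_ge`). The memory depends on the inserted items, but it has only (2u)^m states, and for
each fixed state the failure probability is exponentially small in φgs and φk. Since n ≥ ε m
b^(1+2c), a union bound suffices (`expect_window_cost_ge`). By linearity the inequality can be
summed over windows and integrated over the random choices (`rounds_cost_ge`,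
`tradeoff_of_hashTable`).

It remains to choose parameters. Avoiding collisions requires s of order at most n/b, and the slow
items, of order n/b^c, must be fewer than gs. For c > 1 one group suffices, and all relative losses
are O(φ) with φ^4 = b^(1-c). For c ≤ 1, about b^(1-c) groups are used, which gives about 1/g I/Os
per insertion. -/

namespace ExternalHash

/-- The positions of a sequence at which a previous entry is repeated. -/
noncomputable def repeats {α : Type*} {n : ℕ} (x : Fin n → α) : Finset (Fin n) :=
  open Classical in Finset.univ.filter fun j => ∃ i < j, x i = x j

theorem mem_repeats {α : Type*} {n : ℕ} {x : Fin n → α} {j : Fin n} :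
    j ∈ repeats x ↔ ∃ i < j, x i = x j := by
  simp [repeats]

/-! ### Concentration for independent uniform samples. -/

section Probability

variable {α : Type*} [Fintype α] [Nonempty α]

/-- Resampling one coordinate does not change a uniform expectation. -/
theorem expect_update {ι : Type*} [Fintype ι] [DecidableEq ι] (i : ι) (F : (ι → α) → ℝ) :
    𝔼 x : ι → α, 𝔼 y : α, F (Function.update x i y) = 𝔼 x : ι → α, F x := by
  classical
  have h : ∑ x : ι → α, ∑ y : α, F (Function.update x i y)
      = (Fintype.card α : ℝ) * ∑ x : ι → α, F x := by
    rw [← Fintype.sum_prod_type' (f := fun (x : ι → α) (y : α) => F (Function.update x i y))]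
    -- Exchanging coordinate `i` of `x` with the fresh sample is an involution of the pairs.
    let e : ((ι → α) × α) → ((ι → α) × α) := fun z => (Function.update z.1 i z.2, z.1 i)
    have he : Function.Involutive e := by
      rintro ⟨x, y⟩
      simp [e]
    rw [← Equiv.sum_comp he.toPerm]
    simp [e, Fintype.sum_prod_type, Finset.mul_sum]
  have hc : (Fintype.card α : ℝ) ≠ 0 := by
    exact_mod_cast Fintype.card_ne_zero
  simp only [Fintype.expect_eq_sum_div_card, ← Finset.sum_div]
  rw [h]
  field_simp

/-- If the factor `w j` depends on the coordinates up to `j` only and has mean at most `B j` given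
the coordinates before `j`, then the product of the factors has mean at most `∏ j, B j`. -/
theorem expect_prod_le {n : ℕ} (w : Fin n → (Fin n → α) → ℝ) (B : Fin n → ℝ)
    (hw : ∀ j x, 0 ≤ w j x)
    (hdep : ∀ j i x y, j < i → w j (Function.update x i y) = w j x)
    (hB : ∀ j x, 𝔼 y : α, w j (Function.update x j y) ≤ B j) :
    𝔼 x : Fin n → α, ∏ j, w j x ≤ ∏ j, B j := by
  classical
  have hB0 : ∀ j, 0 ≤ B j := fun j =>
    le_trans (Finset.expect_nonneg fun y _ => hw _ _) (hB j fun _ => Classical.arbitrary α)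
  have key : ∀ K : ℕ, K ≤ n →
      𝔼 x : Fin n → α, ∏ j ∈ Finset.univ.filter (fun j : Fin n => (j : ℕ) < K), w j x ≤ ∏ j ∈ Finset.univ.filter (fun j : Fin n => (j : ℕ) < K), B j := by
    intro K
    induction K with
    | zero => intro _; simp
    | succ K ih =>
      intro hK
      have hs : (Finset.univ.filter fun j : Fin n => (j : ℕ) < K + 1)
          = insert ⟨K, hK⟩ (Finset.univ.filter fun j : Fin n => (j : ℕ) < K) := by
        ext j; simp [Fin.ext_iff]; omega
      have hn : (⟨K, hK⟩ : Fin n) ∉ (Finset.univ.filter fun j : Fin n => (j : ℕ) < K) := by simp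
      rw [hs, Finset.prod_insert hn]
      simp_rw [Finset.prod_insert hn]
      rw [← expect_update (⟨K, hK⟩ : Fin n)]
      have h1 : ∀ x : Fin n → α,
          𝔼 y : α, (w ⟨K, hK⟩ (Function.update x ⟨K, hK⟩ y) *
            ∏ j ∈ Finset.univ.filter (fun j : Fin n => (j : ℕ) < K), w j (Function.update x ⟨K, hK⟩ y))
          ≤ B ⟨K, hK⟩ * ∏ j ∈ Finset.univ.filter (fun j : Fin n => (j : ℕ) < K), w j x := by
        intro x
        have h2 : ∀ y : α, ∏ j ∈ Finset.univ.filter (fun j : Fin n => (j : ℕ) < K), w j (Function.update x ⟨K, hK⟩ y)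
            = ∏ j ∈ Finset.univ.filter (fun j : Fin n => (j : ℕ) < K), w j x := fun y =>
          Finset.prod_congr rfl fun j hj => hdep _ _ _ _ (by
            simpa [Fin.lt_def] using hj)
        simp_rw [h2]
        rw [← Finset.expect_mul]
        exact mul_le_mul_of_nonneg_right (hB _ _) (Finset.prod_nonneg fun j _ => hw _ _)
      calc _ ≤ 𝔼 x : Fin n → α, B ⟨K, hK⟩ * ∏ j ∈ Finset.univ.filter (fun j : Fin n => (j : ℕ) < K), w j x :=
            Finset.expect_le_expect fun x _ => h1 x
        _ = B ⟨K, hK⟩ * 𝔼 x : Fin n → α, ∏ j ∈ Finset.univ.filter (fun j : Fin n => (j : ℕ) < K), w j x := by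
            rw [Finset.mul_expect]
        _ ≤ _ := mul_le_mul_of_nonneg_left (ih (by omega)) (hB0 _)
  simpa using key n le_rfl

theorem expect_ite (P : α → Prop) [DecidablePred P] (a b : ℝ) :
    𝔼 y : α, (if P y then a else b)
      = b + (a - b) * ((Finset.univ.filter P).card / (Fintype.card α : ℝ)) := by
  have hc : (Fintype.card α : ℝ) ≠ 0 := by
    exact_mod_cast Fintype.card_ne_zero
  have : ∀ y, (if P y then a else b) = b + (a - b) * (if P y then 1 else 0) := by
    intro y; split_ifs <;> ring
  simp_rw [this]
  rw [Finset.expect_add_distrib, Fintype.expect_const, ← Finset.mul_expect,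
    Fintype.expect_eq_sum_div_card, Finset.sum_boole]

/-- A lower tail bound for the number of samples that fall into a set of density at least `φ`. -/
theorem expect_lower_tail {n : ℕ} (J : Finset (Fin n)) (A : α → Prop) [DecidablePred A] (φ : ℝ)
    (hA : φ * Fintype.card α ≤ (Finset.univ.filter A).card) :
    𝔼 x : Fin n → α,
      (if ((J.filter fun j => A (x j)).card : ℝ) ≤ φ * J.card / 4 then (1 : ℝ) else 0)
      ≤ Real.exp (-(φ * J.card / 4)) := by
  classical
  have hc : (0 : ℝ) < Fintype.card α := by
    exact_mod_cast Fintype.card_pos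
  -- Exponential moment method with base 1/2: a hit has weight 1/2, so each factor has mean at most
  -- 1 - φ/2.
  have h := expect_prod_le (n := n)
    (fun j (x : Fin n → α) => if j ∈ J then (if A (x j) then (1 / 2 : ℝ) else 1) else 1)
    (fun j => if j ∈ J then 1 - φ / 2 else 1)
    (fun j x => by split_ifs <;> norm_num)
    (fun j i x y hij => by simp [Function.update_of_ne hij.ne])
    (fun j x => by
      by_cases hj : j ∈ J
      · simp only [hj, if_true, Function.update_self]
        rw [expect_ite]
        have := (le_div_iff₀ hc).2 hA
        linarith
      · simp [hj])
  simp only [Finset.prod_ite_mem, Finset.univ_inter, Finset.prod_const] at h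
  have h2 : ∀ x : Fin n → α, ∏ j ∈ J, (if A (x j) then (1 / 2 : ℝ) else 1)
      = (1 / 2 : ℝ) ^ (J.filter fun j => A (x j)).card := by
    intro x
    rw [Finset.prod_ite]; simp
  simp_rw [h2] at h
  -- Makes the base 1 - φ/2 nonnegative, so that powers preserve the inequality.
  have hφ : φ ≤ 1 := by
    have h3 : ((Finset.univ.filter A).card : ℝ) ≤ Fintype.card α := by
      exact_mod_cast Finset.card_le_univ _
    by_contra hcon
    push Not at hcon
    nlinarith
  have h4 : (1 - φ / 2) ^ J.card ≤ Real.exp (-(φ * J.card / 2)) := by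
    have : 1 - φ / 2 ≤ Real.exp (-(φ / 2)) := by
      have := Real.add_one_le_exp (-(φ / 2)); linarith
    calc (1 - φ / 2) ^ J.card ≤ (Real.exp (-(φ / 2))) ^ J.card :=
          pow_le_pow_left₀ (by linarith) this _
      _ = _ := by rw [← Real.exp_nat_mul]; ring_nf
  have h5 : ∀ x : Fin n → α,
      (if ((J.filter fun j => A (x j)).card : ℝ) ≤ φ * J.card / 4 then (1 : ℝ) else 0)
      ≤ Real.exp (φ * J.card / 4) * (1 / 2 : ℝ) ^ (J.filter fun j => A (x j)).card := by
    intro x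
    split_ifs with hx
    · have e : (1 / 2 : ℝ) ^ (J.filter fun j => A (x j)).card
          ≥ Real.exp (-(J.filter fun j => A (x j)).card) := by
        have : Real.exp (-1) ≤ 1 / 2 := by
          rw [Real.exp_neg, one_div]
          refine inv_anti₀ (by norm_num) ?_
          have := Real.add_one_le_exp (1 : ℝ); linarith
        calc Real.exp (-(J.filter fun j => A (x j)).card)
            = Real.exp (-1) ^ (J.filter fun j => A (x j)).card := by
              rw [← Real.exp_nat_mul]; ring_nf
          _ ≤ _ := pow_le_pow_left₀ (Real.exp_pos _).le this _
      calc (1 : ℝ) ≤ Real.exp (φ * J.card / 4 + -(J.filter fun j => A (x j)).card) :=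
            Real.one_le_exp (by linarith)
        _ = Real.exp (φ * J.card / 4) * Real.exp (-(J.filter fun j => A (x j)).card) :=
            Real.exp_add _ _
        _ ≤ _ := mul_le_mul_of_nonneg_left e (Real.exp_pos _).le
    · positivity
  calc _ ≤ 𝔼 x : Fin n → α, Real.exp (φ * J.card / 4)
        * (1 / 2 : ℝ) ^ (J.filter fun j => A (x j)).card := Finset.expect_le_expect fun x _ => h5 x
    _ = Real.exp (φ * J.card / 4) * 𝔼 x : Fin n → α,
        (1 / 2 : ℝ) ^ (J.filter fun j => A (x j)).card := by rw [Finset.mul_expect]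
    _ ≤ Real.exp (φ * J.card / 4) * Real.exp (-(φ * J.card / 2)) :=
        mul_le_mul_of_nonneg_left (h.trans h4) (Real.exp_pos _).le
    _ = _ := by rw [← Real.exp_add]; ring_nf

/-- An upper tail bound for the number of events that occur in a sequence of events, each of which
has probability at most `p` given the past. -/
theorem expect_upper_tail {n : ℕ} (J : Finset (Fin n)) (c : Fin n → (Fin n → α) → Prop)
    [∀ j, DecidablePred (c j)] (p : ℝ) (hp : 0 ≤ p)
    (hdep : ∀ j i x y, j < i → (c j (Function.update x i y) ↔ c j x))
    (hc : ∀ j ∈ J, ∀ x : Fin n → α,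
      ((Finset.univ.filter fun y => c j (Function.update x j y)).card : ℝ)
        ≤ p * Fintype.card α) :
    𝔼 x : Fin n → α,
      (if 4 * (p * J.card) < ((J.filter fun j => c j x).card : ℝ) then (1 : ℝ) else 0)
      ≤ Real.exp (-(p * J.card)) := by
  classical
  have hcard : (0 : ℝ) < Fintype.card α := by
    exact_mod_cast Fintype.card_pos
  -- The same method with weight 2: each conditional mean is at most 1 + p, and 2 ≥ e^(1/2) turns
  -- the threshold 4p|J| into the factor e^(-2p|J|).
  have h := expect_prod_le (n := n)
    (fun j (x : Fin n → α) => if j ∈ J then (if c j x then (2 : ℝ) else 1) else 1)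
    (fun j => if j ∈ J then 1 + p else 1)
    (fun j x => by split_ifs <;> norm_num)
    (fun j i x y hij => by simp only [hdep j i x y hij])
    (fun j x => by
      by_cases hj : j ∈ J
      · simp only [hj, if_true]
        rw [expect_ite]
        have := (div_le_iff₀ hcard).2 (hc j hj x)
        linarith
      · simp [hj])
  simp only [Finset.prod_ite_mem, Finset.univ_inter, Finset.prod_const] at h
  have h2 : ∀ x : Fin n → α, ∏ j ∈ J, (if c j x then (2 : ℝ) else 1)
      = (2 : ℝ) ^ (J.filter fun j => c j x).card := by
    intro x
    rw [Finset.prod_ite]; simp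
  simp_rw [h2] at h
  have h4 : (1 + p) ^ J.card ≤ Real.exp (p * J.card) := by
    have : 1 + p ≤ Real.exp p := by
      have := Real.add_one_le_exp p; linarith
    calc (1 + p) ^ J.card ≤ (Real.exp p) ^ J.card :=
          pow_le_pow_left₀ (by linarith) this _
      _ = _ := by rw [← Real.exp_nat_mul]; ring_nf
  have h5 : ∀ x : Fin n → α,
      (if 4 * (p * J.card) < ((J.filter fun j => c j x).card : ℝ) then (1 : ℝ) else 0)
      ≤ Real.exp (-(2 * (p * J.card))) * (2 : ℝ) ^ (J.filter fun j => c j x).card := by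
    intro x
    split_ifs with hx
    · have e : Real.exp ((J.filter fun j => c j x).card / 2)
          ≤ (2 : ℝ) ^ (J.filter fun j => c j x).card := by
        have : Real.exp (1 / 2) ≤ 2 := by
          rw [← Real.le_log_iff_exp_le (by norm_num)]
          have := Real.log_two_gt_d9; linarith
        calc Real.exp ((J.filter fun j => c j x).card / 2)
            = Real.exp (1 / 2) ^ (J.filter fun j => c j x).card := by
              rw [← Real.exp_nat_mul]; ring_nf
          _ ≤ _ := pow_le_pow_left₀ (Real.exp_pos _).le this _
      calc (1 : ℝ) ≤ Real.exp (-(2 * (p * J.card)) + (J.filter fun j => c j x).card / 2) :=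
            Real.one_le_exp (by linarith)
        _ = Real.exp (-(2 * (p * J.card))) * Real.exp ((J.filter fun j => c j x).card / 2) :=
            Real.exp_add _ _
        _ ≤ _ := mul_le_mul_of_nonneg_left e (Real.exp_pos _).le
    · positivity
  calc _ ≤ 𝔼 x : Fin n → α, Real.exp (-(2 * (p * J.card)))
        * (2 : ℝ) ^ (J.filter fun j => c j x).card := Finset.expect_le_expect fun x _ => h5 x
    _ = Real.exp (-(2 * (p * J.card))) * 𝔼 x : Fin n → α,
        (2 : ℝ) ^ (J.filter fun j => c j x).card := by rw [Finset.mul_expect]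
    _ ≤ Real.exp (-(2 * (p * J.card))) * Real.exp (p * J.card) :=
        mul_le_mul_of_nonneg_left (h.trans h4) (Real.exp_pos _).le
    _ = _ := by rw [← Real.exp_add]; ring_nf

/-- Each repeat is charged to a pair of positions with equal entries; a given pair agrees with
probability 1/|α|. -/
theorem expect_card_repeats_le {n : ℕ} :
    𝔼 x : Fin n → α, ((repeats x).card : ℝ) ≤ (n : ℝ) ^ 2 / Fintype.card α := by
  classical
  have h1 : ∀ x : Fin n → α, ((repeats x).card : ℝ)
      ≤ ∑ j : Fin n, ∑ i : Fin n, if i ≠ j ∧ x j = x i then (1 : ℝ) else 0 := by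
    intro x
    have : ((repeats x).card : ℝ) = ∑ j : Fin n, if ∃ i < j, x i = x j then (1 : ℝ) else 0 := by
      rw [repeats, Finset.sum_boole]
    rw [this]
    refine Finset.sum_le_sum fun j _ => ?_
    split_ifs with h
    · obtain ⟨i, hi, hx⟩ := h
      have := Finset.single_le_sum
        (f := fun i : Fin n => if i ≠ j ∧ x j = x i then (1 : ℝ) else 0)
        (fun i _ => by split_ifs <;> norm_num) (Finset.mem_univ i)
      simpa [hi.ne, hx] using this
    · exact Finset.sum_nonneg fun i _ => by split_ifs <;> norm_num
  have h2 : ∀ i j : Fin n, 𝔼 x : Fin n → α, (if i ≠ j ∧ x j = x i then (1 : ℝ) else 0)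
      ≤ 1 / Fintype.card α := by
    intro i j
    by_cases hij : i = j
    · simp [hij]
    · rw [← expect_update j]
      refine Finset.expect_le (Finset.univ_nonempty) fun x _ => ?_
      simp only [ne_eq, hij, not_false_eq_true, Function.update_self, true_and,
        Function.update_of_ne hij]
      rw [expect_ite]
      have : (Finset.univ.filter fun y : α => y = x i) = {x i} := by ext; simp
      rw [this]
      simp
  calc _ ≤ 𝔼 x : Fin n → α, ∑ j : Fin n, ∑ i : Fin n,
        (if i ≠ j ∧ x j = x i then (1 : ℝ) else 0) := Finset.expect_le_expect fun x _ => h1 x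
    _ = ∑ j : Fin n, ∑ i : Fin n, 𝔼 x : Fin n → α,
        (if i ≠ j ∧ x j = x i then (1 : ℝ) else 0) := by
        rw [Finset.expect_sum_comm]
        exact Finset.sum_congr rfl fun j _ => Finset.expect_sum_comm _ _ _
    _ ≤ ∑ j : Fin n, ∑ i : Fin n, 1 / (Fintype.card α : ℝ) :=
        Finset.sum_le_sum fun j _ => Finset.sum_le_sum fun i _ => h2 i j
    _ = _ := by simp; ring

end Probability


/-! ### What a single indivisible operation can do. -/

theorem card_le_of_subset_items {u k : ℕ} {w : Fin k → Word u} {F : Finset (Fin u)}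
    (hF : ∀ y ∈ F, y ∈ items w) : F.card ≤ k := by
  classical
  choose i hi using fun y : F => hF y y.2
  have := Fintype.card_le_of_injective i fun y z hyz => by
    have h1 := hi y
    rw [hyz, hi z] at h1
    exact Subtype.ext (Word.item.inj h1).symm
  simpa using this

namespace InsertProc

variable {u m b : ℕ}

/-- The witness is the set of blocks accessed in this run. -/
theorem exists_unchanged (p : InsertProc u m b) (D : Disk u b) :
    ∃ S : Finset ℕ, S.card ≤ p.cost D ∧ ∀ a ∉ S, (p.result D).2 a = D a := by
  classical
  induction p generalizing D with
  | halt M => exact ⟨∅, by simp, fun a _ => rfl⟩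
  | access a w k ih =>
    obtain ⟨S, hS, h⟩ := ih (D a) (Function.update D a (w (D a)))
    refine ⟨insert a S, (Finset.card_insert_le _ _).trans (by simpa [cost] using hS), ?_⟩
    intro c hc
    rw [Finset.mem_insert, not_or] at hc
    simp only [result]
    rw [h c hc.2, Function.update_of_ne hc.1]

/-- The items at hand grow with each read; a fixed bound `Z` on all items present makes the
induction go through. -/
theorem Indivisible.items_result {p : InsertProc u m b} {A : Set (Fin u)} (hp : p.Indivisible A)
    {Z : Set (Fin u)} (hA : A ⊆ Z) {D : Disk u b} (hD : ∀ a, items (D a) ⊆ Z) :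
    items (p.result D).1 ⊆ Z ∧ ∀ a, items ((p.result D).2 a) ⊆ Z := by
  induction p generalizing A D with
  | halt M => exact ⟨hp.trans hA, hD⟩
  | access a w k ih =>
    have h := hp (D a)
    have hZ : A ∪ items (D a) ⊆ Z := Set.union_subset hA (hD a)
    refine ih (D a) h.2 hZ fun c => ?_
    by_cases hc : c = a
    · subst hc
      rw [Function.update_self]
      exact h.1.trans hZ
    · rw [Function.update_of_ne hc]
      exact hD c

end InsertProc

namespace QueryProc

variable {u b : ℕ}

/-- The first block read by a query. -/
def first : QueryProc u b → Option ℕ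
  | halt => none
  | read a _ => some a

theorem Visits.one_le_cost {p : QueryProc u b} {D : Disk u b} {x : Fin u} (h : p.Visits D x) :
    1 ≤ p.cost D := by
  cases p with
  | halt => exact h.elim
  | read a k => simp [cost]

theorem Visits.two_le_cost {p : QueryProc u b} {D : Disk u b} {x : Fin u} (h : p.Visits D x)
    (hf : ∀ a, p.first = some a → x ∉ items (D a)) : 2 ≤ p.cost D := by
  cases p with
  | halt => exact h.elim
  | read a k =>
    have := (h.resolve_left (hf a rfl)).one_le_cost
    simp only [cost]
    omega

end QueryProc

/-! ### The table along a sequence of insertions; slow items. -/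

namespace HashTable

variable {u m b n : ℕ} (T : HashTable u m b) (x : Fin n → Fin u)

/-- After `k` insertions, the first block read by the query for the `j`-th item contains it. -/
def Fast (k : ℕ) (j : Fin n) : Prop :=
  ∃ a, (T.query (T.snapshot x k).1 (x j)).first = some a ∧ x j ∈ items ((T.snapshot x k).2 a)

/-- Among the first `k` items, those that the first block read by their query misses. -/
noncomputable def slow (k : ℕ) : Finset (Fin n) :=
  open Classical in Finset.univ.filter fun j => (j : ℕ) < k ∧ ¬ T.Fast x k j

/-- Nothing can be stored before it arrives. This is what forces I/Os for the new items of a window.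
-/
theorem items_snapshot (k : ℕ) :
    items (T.snapshot x k).1 ⊆ {y | ∃ j : Fin n, (j : ℕ) < k ∧ x j = y} ∧
      ∀ a, items ((T.snapshot x k).2 a) ⊆ {y | ∃ j : Fin n, (j : ℕ) < k ∧ x j = y} := by
  induction k with
  | zero => simp [snapshot, T.mem₀_empty, T.disk₀_empty]
  | succ k ih =>
    have hmono : {y | ∃ j : Fin n, (j : ℕ) < k ∧ x j = y}
        ⊆ {y | ∃ j : Fin n, (j : ℕ) < k + 1 ∧ x j = y} :=
      fun y ⟨j, hj, hy⟩ => ⟨j, hj.trans (Nat.lt_succ_self k), hy⟩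
    by_cases h : k < n
    · simp only [snapshot, h, dif_pos]
      refine (T.insert_indivisible _ _).items_result (Set.union_subset (ih.1.trans hmono) ?_)
        fun a => (ih.2 a).trans hmono
      rintro y rfl
      exact ⟨⟨k, h⟩, Nat.lt_succ_self k, rfl⟩
    · simp only [snapshot, h, dif_neg, not_false_eq_true]
      exact ⟨ih.1.trans hmono, fun a => (ih.2 a).trans hmono⟩

/-- The number of I/Os of the insertion number `j`. -/
def stepCost (j : Fin n) : ℕ := (T.insert (T.snapshot x j).1 (x j)).cost (T.snapshot x j).2

theorem exists_unchanged (k₀ l : ℕ) :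
    ∃ S : Finset ℕ,
      S.card ≤ ∑ j ∈ Finset.univ.filter (fun j : Fin n => k₀ ≤ (j : ℕ) ∧ (j : ℕ) < k₀ + l),
        T.stepCost x j ∧
      ∀ a ∉ S, (T.snapshot x (k₀ + l)).2 a = (T.snapshot x k₀).2 a := by
  classical
  induction l with
  | zero => exact ⟨∅, by simp, fun a _ => rfl⟩
  | succ l ih =>
    obtain ⟨S, hS, h⟩ := ih
    by_cases hn : k₀ + l < n
    · obtain ⟨S', hS', h'⟩ := (T.insert (T.snapshot x (k₀ + l)).1
        (x ⟨k₀ + l, hn⟩)).exists_unchanged (T.snapshot x (k₀ + l)).2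
      refine ⟨S' ∪ S, ?_, fun a ha => ?_⟩
      · have hs : (Finset.univ.filter fun j : Fin n => k₀ ≤ (j : ℕ) ∧ (j : ℕ) < k₀ + (l + 1))
            = Insert.insert (⟨k₀ + l, hn⟩ : Fin n)
              (Finset.univ.filter fun j : Fin n => k₀ ≤ (j : ℕ) ∧ (j : ℕ) < k₀ + l) := by
          ext j; simp [Fin.ext_iff]; omega
        rw [hs, Finset.sum_insert (by simp)]
        exact (Finset.card_union_le _ _).trans (Nat.add_le_add hS' hS)
      · rw [Finset.mem_union, not_or] at ha
        rw [← h a ha.2, ← h' a ha.1, ← add_assoc]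
        simp only [snapshot, hn, dif_pos]
    · refine ⟨S, hS.trans (Finset.sum_le_sum_of_subset fun j hj => ?_), fun a ha => ?_⟩
      · simp only [Finset.mem_filter, Finset.mem_univ, true_and] at hj ⊢
        omega
      · rw [← h a ha, ← add_assoc]
        simp only [snapshot, hn, dif_neg, not_false_eq_true]

/-- The items that need more than one I/O are few if the queries are cheap. -/
theorem card_slow_add_le (hT : T.AnswersQueries n) {k : ℕ} (hk : k ≤ n) :
    (T.slow x k).card + k ≤
      ∑ j ∈ Finset.univ.filter (fun j : Fin n => (j : ℕ) < k), T.queryCost x k (x j)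
        + 2 * (m + (repeats x).card) := by
  classical
  set J := Finset.univ.filter (fun j : Fin n => (j : ℕ) < k) with hJ
  set I := J.filter fun j => x j ∈ items (T.snapshot x k).1 with hI
  have hJk : J.card = k := by
    rw [hJ, Fin.card_filter_val_lt, min_eq_right hk]
  have hIc : I.card ≤ m + (repeats x).card := by
    have h1 : (I \ repeats x).card ≤ m := by
      have hinj : Set.InjOn x (I \ repeats x : Finset (Fin n)) := by
        intro i hi j hj hij
        simp only [Finset.coe_sdiff, Set.mem_sdiff, Finset.mem_coe, mem_repeats, not_exists, not_and] at hi hj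
        rcases lt_trichotomy i j with h | h | h
        · exact absurd hij (hj.2 i h)
        · exact h
        · exact absurd hij.symm (hi.2 j h)
      rw [← Finset.card_image_of_injOn hinj]
      refine card_le_of_subset_items (w := (T.snapshot x k).1) fun y hy => ?_
      obtain ⟨j, hj, rfl⟩ := Finset.mem_image.1 hy
      exact (Finset.mem_filter.1 (Finset.mem_sdiff.1 hj).1).2
    have h2 := Finset.le_card_sdiff (repeats x) I
    omega
  have hslow : T.slow x k = J.filter fun j => ¬ T.Fast x k j := by
    rw [slow, hJ, Finset.filter_filter]
  -- An item in memory may be slow and yet cost nothing to query; the term with factor 2 pays for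
  -- it.
  have hpt : ∀ j ∈ J, (if ¬ T.Fast x k j then 1 else 0) + 1 ≤ T.queryCost x k (x j)
      + 2 * (if x j ∈ items (T.snapshot x k).1 then 1 else 0) := by
    intro j hj
    have hjk : (j : ℕ) < k := (Finset.mem_filter.1 hj).2
    rcases hT x k j hk hjk with h | h
    · simp only [h, if_true]; split_ifs <;> omega
    · have h1 : 1 ≤ T.queryCost x k (x j) := h.one_le_cost
      by_cases hf : T.Fast x k j
      · simp only [hf, not_true_eq_false, if_false]; omega
      · have h2 : 2 ≤ T.queryCost x k (x j) :=
          h.two_le_cost fun a ha hx => hf ⟨a, ha, hx⟩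
        simp only [hf, not_false_eq_true, if_true]; omega
  have := Finset.sum_le_sum hpt
  rw [Finset.sum_add_distrib, Finset.sum_add_distrib, ← Finset.mul_sum, ← Finset.card_filter,
    ← Finset.card_filter, ← hslow, ← hI] at this
  simp only [Finset.sum_const, smul_eq_mul, mul_one, hJk] at this
  omega

end HashTable


/-! ### Overload and collisions of an address function. -/

section Addressing

variable {u n : ℕ}

/-- The address function `f` sends no query for `y`, or it sends too many items to the same block
as `y`. -/
def Overloaded (f : Fin u → Option ℕ) (ρ : ℝ) (y : Fin u) : Prop :=
  f y = none ∨ ρ * u < (Finset.univ.filter fun z => f z = f y).card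

/-- The window of positions `k₀, …, k₀ + l - 1`. -/
def window (n k₀ l : ℕ) : Finset (Fin n) :=
  Finset.univ.filter fun j : Fin n => k₀ ≤ (j : ℕ) ∧ (j : ℕ) < k₀ + l

theorem card_window {k₀ l : ℕ} (h : k₀ + l ≤ n) : (window n k₀ l).card = l := by
  have : (window n k₀ l).map Fin.valEmbedding = Finset.Ico k₀ (k₀ + l) := by
    ext a
    simp only [window, Finset.mem_map, Finset.mem_filter, Finset.mem_univ, true_and,
      Fin.valEmbedding_apply, Finset.mem_Ico]
    constructor
    · rintro ⟨j, hj, rfl⟩; exact hj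
    · intro ha; exact ⟨⟨a, by omega⟩, ha, rfl⟩
  rw [← Finset.card_map Fin.valEmbedding, this, Nat.card_Ico]; omega

/-- The `j`-th item is overloaded or it is sent to the same block as an earlier item of its group.
The groups are the intervals of length `s` starting from `k₀`. -/
def Collides (f : Fin u → Option ℕ) (ρ : ℝ) (k₀ s : ℕ) (j : Fin n) (x : Fin n → Fin u) : Prop :=
  Overloaded f ρ (x j) ∨
    ∃ i < j, k₀ ≤ (i : ℕ) ∧ ((i : ℕ) - k₀) / s = ((j : ℕ) - k₀) / s ∧ f (x j) = f (x i)

/-- A collision looks only at earlier items, so it is determined by the coordinates up to `j`, as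
`expect_upper_tail` demands. -/
theorem collides_update {f : Fin u → Option ℕ} {ρ : ℝ} {k₀ s : ℕ} {i j : Fin n} (hij : j < i)
    (x : Fin n → Fin u) (y : Fin u) :
    Collides f ρ k₀ s j (Function.update x i y) ↔ Collides f ρ k₀ s j x := by
  unfold Collides
  rw [Function.update_of_ne hij.ne]
  refine or_congr_right (exists_congr fun l => and_congr_right fun hl => ?_)
  rw [Function.update_of_ne (hl.trans hij).ne]

-- A fresh sample is overloaded with probability at most φ. Otherwise it must hit the fibre of one
-- of at most `s` earlier members of its group, and the fibre of an item that is not overloaded has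
-- density at most ρ.
open Classical in
theorem card_collides_le {f : Fin u → Option ℕ} {ρ φ : ℝ} (hρ : 0 ≤ ρ) {k₀ s : ℕ} (hs : 0 < s)
    (hf : ((Finset.univ.filter (Overloaded f ρ)).card : ℝ) ≤ φ * u) (j : Fin n)
    (x : Fin n → Fin u) :
    ((Finset.univ.filter fun y => Collides f ρ k₀ s j (Function.update x j y)).card : ℝ)
      ≤ (φ + s * ρ) * u := by
  set I : Finset (Fin n) := Finset.univ.filter fun i : Fin n =>
    i < j ∧ k₀ ≤ (i : ℕ) ∧ ((i : ℕ) - k₀) / s = ((j : ℕ) - k₀) / s with hI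
  have hIs : I.card ≤ s := by
    have hsub : I ⊆ window n (k₀ + ((j : ℕ) - k₀) / s * s) s := by
      intro i hi
      simp only [hI, Finset.mem_filter, Finset.mem_univ, true_and] at hi
      simp only [window, Finset.mem_filter, Finset.mem_univ, true_and]
      have h1 := Nat.div_add_mod' ((i : ℕ) - k₀) s
      have h2 := Nat.mod_lt ((i : ℕ) - k₀) hs
      rw [hi.2.2] at h1
      omega
    refine (Finset.card_le_card hsub).trans ?_
    rw [← Finset.card_map Fin.valEmbedding]
    refine (Finset.card_le_card (t := Finset.Ico (k₀ + ((j : ℕ) - k₀) / s * s)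
      (k₀ + ((j : ℕ) - k₀) / s * s + s)) fun a ha => ?_).trans (by simp)
    obtain ⟨i, hi, rfl⟩ := Finset.mem_map.1 ha
    simpa [window] using hi
  have hsub : (Finset.univ.filter fun y => Collides f ρ k₀ s j (Function.update x j y))
      ⊆ Finset.univ.filter (Overloaded f ρ) ∪
        I.biUnion fun i => Finset.univ.filter fun y => f y = f (x i) ∧ ¬ Overloaded f ρ y := by
    intro y hy
    simp only [Finset.mem_filter, Finset.mem_univ, true_and, Collides, Function.update_self] at hy
    simp only [Finset.mem_union, Finset.mem_filter, Finset.mem_univ, true_and, Finset.mem_biUnion]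
    by_cases hy' : Overloaded f ρ y
    · exact Or.inl hy'
    · obtain ⟨i, hij, h1, h2, h3⟩ := hy.resolve_left hy'
      rw [Function.update_of_ne hij.ne] at h3
      exact Or.inr ⟨i, by simp [hI, hij, h1, h2], h3, hy'⟩
  have hfib : ∀ i, ((Finset.univ.filter fun y => f y = f (x i) ∧ ¬ Overloaded f ρ y).card : ℝ)
      ≤ ρ * u := by
    intro i
    rcases Finset.eq_empty_or_nonempty
      (Finset.univ.filter fun y => f y = f (x i) ∧ ¬ Overloaded f ρ y) with h | ⟨y, hy⟩
    · rw [h]; simp; positivity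
    · simp only [Finset.mem_filter, Finset.mem_univ, true_and, Overloaded, not_or, not_lt] at hy
      refine le_trans ?_ hy.2.2
      exact_mod_cast Finset.card_le_card fun z hz => by
        simp only [Finset.mem_filter, Finset.mem_univ, true_and] at hz ⊢
        rw [hz.1, hy.1]
  have h1 : ((Finset.univ.filter fun y => Collides f ρ k₀ s j (Function.update x j y)).card : ℝ)
      ≤ (Finset.univ.filter (Overloaded f ρ)).card +
        ∑ i ∈ I, ((Finset.univ.filter fun y => f y = f (x i) ∧ ¬ Overloaded f ρ y).card : ℝ) := by
    exact_mod_cast (Finset.card_le_card hsub).trans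
      ((Finset.card_union_le _ _).trans (Nat.add_le_add_left Finset.card_biUnion_le _))
  have h2 : ∑ i ∈ I, ((Finset.univ.filter fun y => f y = f (x i) ∧ ¬ Overloaded f ρ y).card : ℝ)
      ≤ s * (ρ * u) := by
    refine (Finset.sum_le_card_nsmul I _ (ρ * u) fun i _ => hfib i).trans ?_
    rw [nsmul_eq_mul]
    exact mul_le_mul_of_nonneg_right (by exact_mod_cast hIs) (by positivity)
  calc _ ≤ _ := h1
    _ ≤ φ * u + s * (ρ * u) := add_le_add hf h2
    _ = _ := by ring

open Classical in
/-- Few blocks are overloaded. -/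
theorem card_image_overloaded_mul_le (f : Fin u → Option ℕ) {ρ : ℝ} (hu : 0 < u) :
    (((Finset.univ.filter fun y => Overloaded f ρ y ∧ f y ≠ none).image f).card : ℝ) * ρ ≤ 1 := by
  set A := (Finset.univ.filter fun y => Overloaded f ρ y ∧ f y ≠ none).image f with hA
  have h1 : ∀ o ∈ A, ρ * u ≤ ((Finset.univ.filter fun z => f z = o).card : ℝ) := by
    intro o ho
    obtain ⟨y, hy, rfl⟩ := Finset.mem_image.1 ho
    simp only [Finset.mem_filter, Finset.mem_univ, true_and] at hy
    exact (hy.1.resolve_left hy.2).le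
  have h2 : ∑ o ∈ A, (Finset.univ.filter fun z => f z = o).card ≤ u := by
    rw [← Finset.card_biUnion]
    · simpa using Finset.card_le_univ (A.biUnion fun o => Finset.univ.filter fun z => f z = o)
    · intro o _ o' _ hoo
      rw [Function.onFun, Finset.disjoint_left]
      intro z hz hz'
      simp only [Finset.mem_filter, Finset.mem_univ, true_and] at hz hz'
      exact hoo (hz.symm.trans hz')
  have h3 := Finset.card_nsmul_le_sum A _ _ h1
  have h4 : (A.card : ℝ) * (ρ * u) ≤ u := by
    rw [nsmul_eq_mul] at h3
    exact h3.trans (by exact_mod_cast h2)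
  have hu' : (0 : ℝ) < u := by exact_mod_cast hu
  have : ((A.card : ℝ) * ρ) * u ≤ 1 * u := by linarith
  exact le_of_mul_le_mul_right this hu'

end Addressing

/-! ### Counting I/Os for a fixed sequence of items. -/

namespace HashTable

variable {u m b n : ℕ} (T : HashTable u m b) (x : Fin n → Fin u)

/-- The block visited first by a query, as a function of the memory contents and the item. -/
def address (M : Memory u m) (y : Fin u) : Option ℕ := (T.query M y).first

open Classical in
/-- Items that are stored at their address and do not collide have caused distinct I/Os. -/
theorem window_card_le {k₀ g s : ℕ} (ρ : ℝ) (hs : 0 < s) (h : k₀ + g * s ≤ n) :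
    g * s ≤ g * ∑ j ∈ window n k₀ (g * s), T.stepCost x j +
      ((window n k₀ (g * s)).filter fun j =>
        Collides (T.address (T.snapshot x (k₀ + g * s)).1) ρ k₀ s j x).card +
      (T.slow x (k₀ + g * s)).card + (repeats x).card := by
  set f := T.address (T.snapshot x (k₀ + g * s)).1 with hf
  obtain ⟨S, hS, hS'⟩ := T.exists_unchanged x k₀ (g * s)
  change S.card ≤ ∑ j ∈ window n k₀ (g * s), T.stepCost x j at hS
  set J := window n k₀ (g * s) with hJ
  set G := J.filter fun j => ¬ Collides f ρ k₀ s j x ∧ j ∉ T.slow x (k₀ + g * s) ∧ j ∉ repeats x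
    with hG
  have hJG : J ⊆ G ∪ J.filter (fun j => Collides f ρ k₀ s j x) ∪ T.slow x (k₀ + g * s) ∪
      repeats x := by
    intro j hj
    simp only [hG, Finset.mem_union, Finset.mem_filter, hj, true_and]
    tauto
  have hJc : J.card = g * s := card_window h
  -- Were the block unchanged, the item would have been on disk at time `k₀`, hence equal to an
  -- earlier one: a repeat.
  have hGS : ∀ j ∈ G, ∃ a ∈ S, f (x j) = some a := by
    intro j hj
    obtain ⟨hjJ, _, hslow, hrep⟩ := Finset.mem_filter.1 hj
    simp only [hJ, window, Finset.mem_filter, Finset.mem_univ, true_and] at hjJ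
    simp only [slow, Finset.mem_filter, Finset.mem_univ, true_and, not_and, not_not] at hslow
    obtain ⟨a, ha, hxa⟩ := hslow hjJ.2
    refine ⟨a, ?_, ha⟩
    by_contra haS
    rw [hS' a haS] at hxa
    obtain ⟨i, hi, hxi⟩ := (T.items_snapshot x k₀).2 a hxa
    refine hrep (mem_repeats.2 ⟨i, ?_, hxi⟩)
    rw [Fin.lt_def]; omega
  -- Within one group the addresses of items of `G` are distinct members of `S`. The default in
  -- `getD 0` is never used, since these addresses exist.
  have hGc : G.card ≤ S.card * g := by
    have := Finset.card_le_mul_card_image_of_maps_to (s := G) (t := Finset.range g)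
      (f := fun j : Fin n => ((j : ℕ) - k₀) / s) (fun j hj => by
        have hjJ := (Finset.mem_filter.1 hj).1
        simp only [hJ, window, Finset.mem_filter, Finset.mem_univ, true_and] at hjJ
        rw [Finset.mem_range, Nat.div_lt_iff_lt_mul hs]
        omega) S.card (fun γ _ => by
        refine Finset.card_le_card_of_injOn (fun j => (f (x j)).getD 0) (fun j hj => ?_) ?_
        · obtain ⟨a, ha, hfa⟩ := hGS j (Finset.mem_filter.1 hj).1
          simpa [hfa] using ha
        · intro i hi j hj hij
          have hi' := Finset.mem_filter.1 (Finset.mem_coe.1 hi)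
          have hj' := Finset.mem_filter.1 (Finset.mem_coe.1 hj)
          obtain ⟨a, _, hfa⟩ := hGS i hi'.1
          obtain ⟨a', _, hfa'⟩ := hGS j hj'.1
          simp only [hfa, hfa', Option.getD_some] at hij
          subst hij
          have hiG := Finset.mem_filter.1 hi'.1
          have hjG := Finset.mem_filter.1 hj'.1
          have hiJ := (Finset.mem_filter.1 hiG.1).2
          have hjJ := (Finset.mem_filter.1 hjG.1).2
          rcases lt_trichotomy i j with h | h | h
          · exact absurd (Or.inr ⟨i, h, hiJ.1, hi'.2.trans hj'.2.symm, hfa'.trans hfa.symm⟩)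
              hjG.2.1
          · exact h
          · exact absurd (Or.inr ⟨j, h, hjJ.1, hj'.2.trans hi'.2.symm, hfa.trans hfa'.symm⟩)
              hiG.2.1)
    rwa [Finset.card_range] at this
  have h1 := Finset.card_le_card hJG
  have h2 := Finset.card_union_le (G ∪ J.filter (fun j => Collides f ρ k₀ s j x) ∪
    T.slow x (k₀ + g * s)) (repeats x)
  have h3 := Finset.card_union_le (G ∪ J.filter (fun j => Collides f ρ k₀ s j x))
    (T.slow x (k₀ + g * s))
  have h4 := Finset.card_union_le G (J.filter (fun j => Collides f ρ k₀ s j x))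
  have h5 : S.card * g ≤ g * ∑ j ∈ J, T.stepCost x j := by
    rw [mul_comm]; exact Nat.mul_le_mul_left _ hS
  omega

open Classical in
/-- The blocks that are overloaded by the address function can hold only few items. -/
theorem card_overloaded_le (k : ℕ) {ρ : ℝ} (hρ : 0 < ρ) (hu : 0 < u) :
    (((window n 0 k).filter fun j =>
        Overloaded (T.address (T.snapshot x k).1) ρ (x j)).card : ℝ)
      ≤ (T.slow x k).card + (repeats x).card + b / ρ := by
  set f := T.address (T.snapshot x k).1 with hf
  set A := (Finset.univ.filter fun y => Overloaded f ρ y ∧ f y ≠ none).image f with hA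
  set O := (window n 0 k).filter fun j => Overloaded f ρ (x j) with hO
  set G := O.filter fun j => j ∉ T.slow x k ∧ j ∉ repeats x with hG
  have hOG : O ⊆ G ∪ T.slow x k ∪ repeats x := by
    intro j hj
    simp only [hG, Finset.mem_union, Finset.mem_filter, hj, true_and]
    tauto
  have hGf : ∀ j ∈ G, ∃ a, f (x j) = some a ∧ x j ∈ items ((T.snapshot x k).2 a) := by
    intro j hj
    obtain ⟨hjO, hslow, _⟩ := Finset.mem_filter.1 hj
    have hjk := (Finset.mem_filter.1 (Finset.mem_filter.1 hjO).1).2.2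
    simp only [slow, Finset.mem_filter, Finset.mem_univ, true_and, not_and, not_not] at hslow
    exact hslow (by omega)
  have hinj : Set.InjOn x G := by
    intro i hi j hj hij
    have hi := (Finset.mem_filter.1 (Finset.mem_coe.1 hi)).2.2
    have hj := (Finset.mem_filter.1 (Finset.mem_coe.1 hj)).2.2
    simp only [mem_repeats, not_exists, not_and] at hi hj
    rcases lt_trichotomy i j with h | h | h
    · exact absurd hij (hj i h)
    · exact h
    · exact absurd hij.symm (hi j h)
  -- Each heavy block holds at most `b` distinct items, and `x` is injective on `G`.
  have hGc : G.card ≤ b * A.card := by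
    refine Finset.card_le_mul_card_image_of_maps_to (f := fun j => f (x j)) (fun j hj => ?_) b
      fun o _ => ?_
    · obtain ⟨a, ha, _⟩ := hGf j hj
      refine Finset.mem_coe.2 (Finset.mem_image_of_mem f ?_)
      simp only [Finset.mem_filter, Finset.mem_univ, true_and]
      exact ⟨(Finset.mem_filter.1 (Finset.mem_filter.1 hj).1).2, by simp [ha]⟩
    · rw [← Finset.card_image_of_injOn (hinj.mono (Finset.coe_subset.2 (Finset.filter_subset _ _)))]
      refine card_le_of_subset_items (w := (T.snapshot x k).2 (o.getD 0)) fun y hy => ?_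
      obtain ⟨j, hj, rfl⟩ := Finset.mem_image.1 hy
      obtain ⟨hjG, hjo⟩ := Finset.mem_filter.1 hj
      obtain ⟨a, ha, hx⟩ := hGf j hjG
      simpa [← hjo, ha] using hx
  have hAρ : (A.card : ℝ) ≤ 1 / ρ := (le_div_iff₀ hρ).2 (card_image_overloaded_mul_le f hu)
  have h1 : (O.card : ℝ) ≤ G.card + (T.slow x k).card + (repeats x).card := by
    exact_mod_cast (Finset.card_le_card hOG).trans ((Finset.card_union_le _ _).trans
      (Nat.add_le_add_right (Finset.card_union_le _ _) _))
  have h2 : (G.card : ℝ) ≤ b * A.card := by exact_mod_cast hGc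
  have h3 : (b : ℝ) * A.card ≤ b / ρ := by
    calc (b : ℝ) * A.card ≤ b * (1 / ρ) := mul_le_mul_of_nonneg_left hAρ (Nat.cast_nonneg _)
      _ = b / ρ := by ring
  linarith

end HashTable


/-! ### Averaging over the items, with a union bound over memory contents. -/

/-- A word is an item or data. -/
def wordEquiv (u : ℕ) : Word u ≃ Fin u ⊕ Fin u where
  toFun
    | .item x => .inl x
    | .data d => .inr d
  invFun
    | .inl x => .item x
    | .inr d => .data d
  left_inv w := by cases w <;> rfl
  right_inv w := by cases w <;> rfl

instance (u : ℕ) : Fintype (Word u) := Fintype.ofEquiv _ (wordEquiv u).symm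

theorem card_memory (u m : ℕ) : Fintype.card (Memory u m) = (2 * u) ^ m := by
  classical
  rw [Fintype.card_fun, Fintype.card_fin, Fintype.card_congr (wordEquiv u), Fintype.card_sum,
    Fintype.card_fin, two_mul]

/-- The union bound. -/
theorem expect_exists_le {X ι : Type*} [Fintype X] [Fintype ι] (P : ι → X → Prop)
    [∀ i, DecidablePred (P i)] [DecidablePred fun x => ∃ i, P i x] {a : ℝ}
    (h : ∀ i, 𝔼 x, (if P i x then (1 : ℝ) else 0) ≤ a) :
    𝔼 x, (if ∃ i, P i x then (1 : ℝ) else 0) ≤ Fintype.card ι * a := by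
  calc 𝔼 x, (if ∃ i, P i x then (1 : ℝ) else 0)
      ≤ 𝔼 x, ∑ i, (if P i x then (1 : ℝ) else 0) := by
        refine Finset.expect_le_expect fun x _ => ?_
        split_ifs with hx
        · obtain ⟨i, hi⟩ := hx
          have := Finset.single_le_sum (f := fun i => if P i x then (1 : ℝ) else 0)
            (fun i _ => by split_ifs <;> norm_num) (Finset.mem_univ i)
          simpa [hi] using this
        · exact Finset.sum_nonneg fun i _ => by split_ifs <;> norm_num
    _ = ∑ i, 𝔼 x, (if P i x then (1 : ℝ) else 0) := Finset.expect_sum_comm _ _ _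
    _ ≤ ∑ _i : ι, a := Finset.sum_le_sum fun i _ => h i
    _ = _ := by simp

namespace HashTable

variable {u m b n : ℕ} (T : HashTable u m b)

theorem coe_meanInsertionCost :
    (T.meanInsertionCost n : ℝ) = 𝔼 x : Fin n → Fin u, ∑ j, (T.stepCost x j : ℝ) := by
  simp only [meanInsertionCost, Fintype.expect_eq_sum_div_card, insertionCost, stepCost]
  push_cast
  rfl

theorem mul_coe_meanQueryCost {k : ℕ} (hk0 : 1 ≤ k) (hk : k ≤ n) :
    k * (T.meanQueryCost n k : ℝ) = 𝔼 x : Fin n → Fin u,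
      ∑ j ∈ Finset.univ.filter (fun j : Fin n => (j : ℕ) < k), (T.queryCost x k (x j) : ℝ) := by
  have hc : (Finset.univ.filter (fun j : Fin n => (j : ℕ) < k)).card = k := by
    rw [Fin.card_filter_val_lt, min_eq_right hk]
  have hk' : (k : ℝ) ≠ 0 := by exact_mod_cast (by omega : k ≠ 0)
  simp only [meanQueryCost, Finset.expect_eq_sum_div_card, hc]
  push_cast
  rw [← Finset.sum_div]
  field_simp

/-- In 5m, memory accounts for 2m; the repeats enter three times, and their expected number is at
most n²/u ≤ 1 ≤ m. -/
theorem expect_slow_le [NeZero u] (hT : T.AnswersQueries n) (hm : 1 ≤ m) (hu : n ^ 2 ≤ u) {k : ℕ}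
    (hk0 : 1 ≤ k) (hk : k ≤ n) :
    𝔼 x : Fin n → Fin u, (((T.slow x k).card : ℝ) + (repeats x).card)
      ≤ k * (T.meanQueryCost n k : ℝ) - k + 5 * m := by
  have hrep : 𝔼 x : Fin n → Fin u, ((repeats x).card : ℝ) ≤ m := by
    refine expect_card_repeats_le.trans ?_
    have h1 : (n : ℝ) ^ 2 ≤ u := by exact_mod_cast hu
    have h2 : (1 : ℝ) ≤ m := by exact_mod_cast hm
    have h3 : (0 : ℝ) < u := by exact_mod_cast Nat.pos_of_ne_zero (NeZero.ne u)
    rw [Fintype.card_fin]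
    exact ((div_le_one h3).2 h1).trans h2
  have hpt : ∀ x : Fin n → Fin u, ((T.slow x k).card : ℝ) + (repeats x).card ≤
      ∑ j ∈ Finset.univ.filter (fun j : Fin n => (j : ℕ) < k), (T.queryCost x k (x j) : ℝ)
        + (2 * m - k + 3 * (repeats x).card) := by
    intro x
    have := T.card_slow_add_le x hT hk
    have h : ((T.slow x k).card : ℝ) + k ≤
        ∑ j ∈ Finset.univ.filter (fun j : Fin n => (j : ℕ) < k), (T.queryCost x k (x j) : ℝ)
          + 2 * (m + (repeats x).card) := by exact_mod_cast this
    linarith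
  calc _ ≤ 𝔼 x : Fin n → Fin u,
        (∑ j ∈ Finset.univ.filter (fun j : Fin n => (j : ℕ) < k), (T.queryCost x k (x j) : ℝ)
        + (2 * m - k + 3 * (repeats x).card)) := Finset.expect_le_expect fun x _ => hpt x
    _ = k * (T.meanQueryCost n k : ℝ) + (2 * m - k
          + 3 * 𝔼 x : Fin n → Fin u, ((repeats x).card : ℝ)) := by
        rw [Finset.expect_add_distrib, ← T.mul_coe_meanQueryCost hk0 hk,
          Finset.expect_add_distrib, Fintype.expect_const, Finset.mul_expect]
    _ ≤ _ := by linarith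

open Classical in
/-- A lower bound for the cost of the insertions in a window, for one sequence of items. -/
theorem window_cost_ge (x : Fin n → Fin u) (hu : 0 < u) {k₀ g s : ℕ} (hg : 0 < g) (hs : 0 < s)
    (hk : k₀ + g * s ≤ n) {φ ρ κ : ℝ} (hφ : 0 < φ) (hρ : 0 < ρ)
    (hb : b / ρ ≤ φ * ((k₀ + g * s : ℕ) : ℝ) / 8)
    (hκ : 1 / (g : ℝ) + 8 * s / (φ * ((k₀ + g * s : ℕ) : ℝ)) ≤ κ) :
    (s : ℝ) * (1 - 4 * (φ + s * ρ))
      ≤ ∑ j ∈ window n k₀ (g * s), (T.stepCost x j : ℝ)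
        + κ * ((T.slow x (k₀ + g * s)).card + (repeats x).card)
        + s * (if ∃ M, ((Finset.univ.filter (Overloaded (T.address M) ρ)).card : ℝ) ≤ φ * u ∧
            4 * ((φ + s * ρ) * (window n k₀ (g * s)).card) < (((window n k₀ (g * s)).filter
              fun j => Collides (T.address M) ρ k₀ s j x).card : ℝ) then (1 : ℝ) else 0)
        + s * (if ∃ M, φ * u ≤ ((Finset.univ.filter (Overloaded (T.address M) ρ)).card : ℝ) ∧
            (((window n 0 (k₀ + g * s)).filter fun j =>
              Overloaded (T.address M) ρ (x j)).card : ℝ)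
                ≤ φ * (window n 0 (k₀ + g * s)).card / 4 then (1 : ℝ) else 0) := by
  have hcost : 0 ≤ ∑ j ∈ window n k₀ (g * s), (T.stepCost x j : ℝ) :=
    Finset.sum_nonneg fun _ _ => Nat.cast_nonneg _
  have hg' : (0 : ℝ) < g := by exact_mod_cast hg
  have hs' : (0 : ℝ) < s := by exact_mod_cast hs
  have hk' : (0 : ℝ) < ((k₀ + g * s : ℕ) : ℝ) := by
    exact_mod_cast Nat.add_pos_right _ (Nat.mul_pos hg hs)
  have hκ1 : 1 / (g : ℝ) ≤ κ := le_trans (le_add_of_nonneg_right (by positivity)) hκ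
  have hκ2 : 8 * s / (φ * ((k₀ + g * s : ℕ) : ℝ)) ≤ κ :=
    le_trans (le_add_of_nonneg_left (by positivity)) hκ
  have hκ0 : 0 ≤ κ := le_trans (by positivity) hκ1
  set q : ℝ := ((T.slow x (k₀ + g * s)).card : ℝ) + (repeats x).card with hq
  have hq0 : 0 ≤ q := by positivity
  have hκq : 0 ≤ κ * q := mul_nonneg hκ0 hq0
  have hsmall : (s : ℝ) * (1 - 4 * (φ + s * ρ)) ≤ s := by
    have : 0 ≤ (s : ℝ) * (4 * (φ + s * ρ)) := by positivity
    linarith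
  -- If an exceptional event occurs, its term `s` alone exceeds the left side.
  split_ifs with h1 h2 h2
  · linarith
  · linarith
  · linarith
  · push Not at h1 h2
    -- The actual memory depends on `x`; this is why the exceptional events quantify over all `M`.
    set M := (T.snapshot x (k₀ + g * s)).1 with hM
    rw [card_window hk] at h1
    rw [card_window (by omega)] at h2
    rcases le_total ((Finset.univ.filter (Overloaded (T.address M) ρ)).card : ℝ) (φ * u)
      with hgood | hbad
    · have h3 := h1 M hgood
      have h4 : ((g * s : ℕ) : ℝ) ≤ g * ∑ j ∈ window n k₀ (g * s), (T.stepCost x j : ℝ) +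
          ((window n k₀ (g * s)).filter fun j => Collides (T.address M) ρ k₀ s j x).card + q := by
        rw [hq, ← add_assoc]
        exact_mod_cast T.window_card_le x ρ hs hk
      push_cast at h3 h4
      have h5 : (g : ℝ) * (s * (1 - 4 * (φ + s * ρ))) ≤
          g * (∑ j ∈ window n k₀ (g * s), (T.stepCost x j : ℝ) + 1 / g * q) := by
        have : (g : ℝ) * (1 / g * q) = q := by field_simp
        rw [mul_add (g : ℝ) _ (1 / (g : ℝ) * q), this]
        linarith
      have h6 := le_of_mul_le_mul_left h5 hg'
      have h7 := mul_le_mul_of_nonneg_right hκ1 hq0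
      linarith
    · have h3 := h2 M hbad
      have h4 := T.card_overloaded_le x (k₀ + g * s) hρ hu
      rw [← hq, ← hM] at h4
      -- More than φk/4 items are overloaded and at most b/ρ ≤ φk/8 of them can be served by heavy
      -- blocks. By the choice of κ, the rest outweighs `s`.
      have h5 : φ * ((k₀ + g * s : ℕ) : ℝ) / 8 ≤ q := by linarith
      have h6 : (s : ℝ) ≤ κ * q := by
        calc (s : ℝ) = 8 * s / (φ * ((k₀ + g * s : ℕ) : ℝ)) * (φ * ((k₀ + g * s : ℕ) : ℝ) / 8) := by
              field_simp
          _ ≤ κ * q := mul_le_mul hκ2 h5 (by positivity) hκ0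
      linarith

/-- A lower bound for the expected cost of the insertions in a window. -/
theorem expect_window_cost_ge [NeZero u] (hT : T.AnswersQueries n) (hm : 1 ≤ m) (hu : n ^ 2 ≤ u)
    {k₀ g s : ℕ} (hg : 0 < g) (hs : 0 < s) (hk : k₀ + g * s ≤ n) {φ ρ κ η : ℝ} (hφ : 0 < φ)
    (hρ : 0 < ρ) (hb : b / ρ ≤ φ * ((k₀ + g * s : ℕ) : ℝ) / 8)
    (hκ : 1 / (g : ℝ) + 8 * s / (φ * ((k₀ + g * s : ℕ) : ℝ)) ≤ κ)
    (hη : (2 * u : ℝ) ^ m * (Real.exp (-(φ * ((g * s : ℕ) : ℝ)))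
      + Real.exp (-(φ * ((k₀ + g * s : ℕ) : ℝ) / 4))) ≤ η) :
    (s : ℝ) * (1 - 4 * (φ + s * ρ) - η)
      ≤ 𝔼 x : Fin n → Fin u, ∑ j ∈ window n k₀ (g * s), (T.stepCost x j : ℝ)
        + κ * (((k₀ + g * s : ℕ) : ℝ) * T.meanQueryCost n (k₀ + g * s)
            - ((k₀ + g * s : ℕ) : ℝ) + 5 * m) := by
  classical
  have hu0 : 0 < u := Nat.pos_of_ne_zero (NeZero.ne u)
  have hgs : 0 < g * s := Nat.mul_pos hg hs
  have hcardM : (Fintype.card (Memory u m) : ℝ) = (2 * u : ℝ) ^ m := by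
    rw [card_memory]; push_cast; rfl
  have hκ0 : 0 ≤ κ := le_trans (by positivity) hκ
  set E₁ : Memory u m → (Fin n → Fin u) → Prop := fun M x =>
    ((Finset.univ.filter (Overloaded (T.address M) ρ)).card : ℝ) ≤ φ * u ∧
            4 * ((φ + s * ρ) * (window n k₀ (g * s)).card) < (((window n k₀ (g * s)).filter
              fun j => Collides (T.address M) ρ k₀ s j x).card : ℝ) with hE₁
  set E₂ : Memory u m → (Fin n → Fin u) → Prop := fun M x =>
    φ * u ≤ ((Finset.univ.filter (Overloaded (T.address M) ρ)).card : ℝ) ∧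
            (((window n 0 (k₀ + g * s)).filter fun j =>
              Overloaded (T.address M) ρ (x j)).card : ℝ)
                ≤ φ * (window n 0 (k₀ + g * s)).card / 4 with hE₂
  have h₁ : ∀ M, 𝔼 x, (if E₁ M x then (1 : ℝ) else 0) ≤ Real.exp (-(φ * ((g * s : ℕ) : ℝ))) := by
    intro M
    -- For fixed `M` this condition does not involve the samples.
    by_cases hM : ((Finset.univ.filter (Overloaded (T.address M) ρ)).card : ℝ) ≤ φ * u
    · have := expect_upper_tail (α := Fin u) (window n k₀ (g * s))
        (fun j x => Collides (T.address M) ρ k₀ s j x) (φ + s * ρ) (by positivity)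
        (fun j i x y hij => collides_update hij x y)
        (fun j _ x => by
          rw [Fintype.card_fin]
          convert card_collides_le hρ.le hs hM j x)
      simp only [hE₁, hM, true_and]
      refine le_trans (le_of_eq ?_) (this.trans (Real.exp_le_exp.2 ?_))
      · rfl
      · rw [card_window hk]
        have : 0 ≤ (s * ρ) * ((g * s : ℕ) : ℝ) := by positivity
        linarith
    · simp only [hE₁, hM, false_and, if_false, Finset.expect_const_zero]
      positivity
  have h₂ : ∀ M, 𝔼 x, (if E₂ M x then (1 : ℝ) else 0)
      ≤ Real.exp (-(φ * ((k₀ + g * s : ℕ) : ℝ) / 4)) := by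
    intro M
    by_cases hM : φ * u ≤ ((Finset.univ.filter (Overloaded (T.address M) ρ)).card : ℝ)
    · have := expect_lower_tail (α := Fin u) (window n 0 (k₀ + g * s))
        (Overloaded (T.address M) ρ) φ (by rwa [Fintype.card_fin])
      simp only [hE₂, hM, true_and]
      refine this.trans (le_of_eq ?_)
      rw [card_window (by omega)]
    · simp only [hE₂, hM, false_and, if_false, Finset.expect_const_zero]
      positivity
  have h₃ := expect_exists_le E₁ h₁
  have h₄ := expect_exists_le E₂ h₂
  rw [hcardM] at h₃ h₄
  have h₅ := T.expect_slow_le hT hm hu (show 1 ≤ k₀ + g * s by omega) hk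
  have h₆ := Finset.expect_le_expect (s := (Finset.univ : Finset (Fin n → Fin u)))
    fun x _ => T.window_cost_ge x hu0 hg hs hk hφ hρ hb hκ
  rw [Fintype.expect_const, Finset.expect_add_distrib, Finset.expect_add_distrib,
    Finset.expect_add_distrib, ← Finset.mul_expect, ← Finset.mul_expect, ← Finset.mul_expect] at h₆
  have h₇ := mul_le_mul_of_nonneg_left h₅ hκ0
  have hs0 : (0 : ℝ) ≤ s := Nat.cast_nonneg _
  have h₈ := mul_le_mul_of_nonneg_left h₃ hs0
  have h₉ := mul_le_mul_of_nonneg_left h₄ hs0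
  have h₁₀ := mul_le_mul_of_nonneg_left hη hs0
  have h₁₁ : (s : ℝ) * (1 - 4 * (φ + s * ρ)) ≤ _ := h₆
  linarith

/-- The tradeoff between the insertion cost and the query costs of a deterministic hash table, for
`R` consecutive windows of `g * s` insertions. -/
theorem rounds_cost_ge [NeZero u] (hT : T.AnswersQueries n) (hm : 1 ≤ m) (hu : n ^ 2 ≤ u)
    {k₁ R g s : ℕ} (hk₁ : 0 < k₁) (hg : 0 < g) (hs : 0 < s) (hk : k₁ + R * (g * s) ≤ n)
    {φ ρ κ η : ℝ} (hφ : 0 < φ) (hρ : 0 < ρ) (hb : b / ρ ≤ φ * k₁ / 8)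
    (hκ : 1 / (g : ℝ) + 8 * s / (φ * k₁) ≤ κ)
    (hη : (2 * u : ℝ) ^ m * (Real.exp (-(φ * ((g * s : ℕ) : ℝ)))
      + Real.exp (-(φ * k₁ / 4))) ≤ η) :
    R * ((s : ℝ) * (1 - 4 * (φ + s * ρ) - η)) + κ * ∑ i ∈ Finset.range R,
        ((k₁ + (i + 1) * (g * s) : ℕ) : ℝ)
      ≤ T.meanInsertionCost n + ∑ i ∈ Finset.range R, (κ * ((k₁ + (i + 1) * (g * s) : ℕ) : ℝ))
            * (T.meanQueryCost n (k₁ + (i + 1) * (g * s)) : ℝ) + R * (κ * (5 * m)) := by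
  classical
  have hround : ∀ i ∈ Finset.range R, (s : ℝ) * (1 - 4 * (φ + s * ρ) - η)
      ≤ 𝔼 x : Fin n → Fin u, ∑ j ∈ window n (k₁ + i * (g * s)) (g * s), (T.stepCost x j : ℝ)
        + κ * (((k₁ + (i + 1) * (g * s) : ℕ) : ℝ) * T.meanQueryCost n (k₁ + (i + 1) * (g * s))
            - ((k₁ + (i + 1) * (g * s) : ℕ) : ℝ) + 5 * m) := by
    intro i hi
    have hi' : (i + 1) * (g * s) ≤ R * (g * s) :=
      Nat.mul_le_mul_right _ (Finset.mem_range.1 hi)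
    have he : k₁ + i * (g * s) + g * s = k₁ + (i + 1) * (g * s) := by ring
    have hk₁' : (0 : ℝ) < k₁ := by exact_mod_cast hk₁
    have hle : (k₁ : ℝ) ≤ ((k₁ + i * (g * s) + g * s : ℕ) : ℝ) := by
      exact_mod_cast (by omega : k₁ ≤ k₁ + i * (g * s) + g * s)
    -- The conditions on the parameters only weaken as the end of the window moves beyond `k₁`.
    have := T.expect_window_cost_ge hT hm hu (k₀ := k₁ + i * (g * s)) (κ := κ) (η := η) hg hs
      (by omega) hφ hρ (hb.trans (by gcongr)) (le_trans (by gcongr) hκ) (le_trans (by gcongr) hη)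
    rwa [he] at this
  have hsum := Finset.sum_le_sum hround
  have hwin : ∑ i ∈ Finset.range R, 𝔼 x : Fin n → Fin u,
      ∑ j ∈ window n (k₁ + i * (g * s)) (g * s), (T.stepCost x j : ℝ) ≤ T.meanInsertionCost n := by
    rw [coe_meanInsertionCost, ← Finset.expect_sum_comm]
    refine Finset.expect_le_expect fun x _ => ?_
    rw [← Finset.sum_biUnion]
    · exact Finset.sum_le_sum_of_subset_of_nonneg (Finset.subset_univ _)
        fun _ _ _ => Nat.cast_nonneg _
    · intro i _ i' _ hii
      rw [Function.onFun, Finset.disjoint_left]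
      intro j hj hj'
      simp only [window, Finset.mem_filter, Finset.mem_univ, true_and] at hj hj'
      rcases lt_or_gt_of_ne hii with h | h
      · have := Nat.mul_le_mul_right (g * s) (Nat.succ_le_of_lt h)
        rw [Nat.succ_mul] at this; omega
      · have := Nat.mul_le_mul_right (g * s) (Nat.succ_le_of_lt h)
        rw [Nat.succ_mul] at this; omega
  rw [Finset.sum_const, Finset.card_range, nsmul_eq_mul, Finset.sum_add_distrib,
    ← Finset.mul_sum, Finset.sum_add_distrib, Finset.sum_sub_distrib, Finset.sum_const,
    Finset.card_range, nsmul_eq_mul] at hsum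
  simp only [mul_assoc κ, ← Finset.mul_sum]
  linarith

end HashTable


/-! ### From deterministic to randomized tables. -/

/-- The tradeoff between the insertion cost `tu` and the query cost `1 + δ` of hash tables, for all
choices of the parameters. -/
def Tradeoff (u m b n : ℕ) (δ tu : ℝ) : Prop :=
  ∀ (k₁ R g s : ℕ) (φ ρ κ η : ℝ), 0 < k₁ → 0 < g → 0 < s → k₁ + R * (g * s) ≤ n → 0 < φ → 0 < ρ →
    b / ρ ≤ φ * k₁ / 8 → 1 / (g : ℝ) + 8 * s / (φ * k₁) ≤ κ →
    (2 * u : ℝ) ^ m * (Real.exp (-(φ * ((g * s : ℕ) : ℝ))) + Real.exp (-(φ * k₁ / 4))) ≤ η →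
    R * ((s : ℝ) * (1 - 4 * (φ + s * ρ) - η) - κ * (n * δ + 5 * m)) ≤ n * tu

theorem HashTable.measurable_meanQueryCost {Ω : Type*} [MeasurableSpace Ω] {u m b n : ℕ}
    {T : Ω → HashTable u m b}
    (hT : ∀ (x : Fin n → Fin u) (k : ℕ) (y : Fin u), Measurable fun r => (T r).queryCost x k y)
    (k : ℕ) : Measurable fun r => ((T r).meanQueryCost n k : ℝ≥0∞) := by
  refine Measurable.coe_nnreal_ennreal ?_
  simp only [HashTable.meanQueryCost, Finset.expect_eq_sum_div_card]
  refine Measurable.div_const (Finset.measurable_sum _ fun x _ => Measurable.div_const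
    (Finset.measurable_sum _ fun j _ => ?_) _) _
  exact (measurable_from_nat (f := fun a : ℕ => (a : ℝ≥0))).comp (hT x k (x j))

/-- Randomized hash tables satisfy the tradeoff between insertion and query costs. -/
theorem tradeoff_of_hashTable {u m b n : ℕ} [NeZero u] (hm : 1 ≤ m) (hu : n ^ 2 ≤ u)
    {Ω : Type*} [MeasurableSpace Ω] (P : Measure Ω) [IsProbabilityMeasure P]
    (T : Ω → HashTable u m b) (hT : ∀ r, (T r).AnswersQueries n)
    (hmeas : ∀ (x : Fin n → Fin u) (k : ℕ) (y : Fin u),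
      Measurable fun r => (T r).queryCost x k y)
    {tq tu : ℝ≥0}
    (htq : ∀ k : ℕ, 1 ≤ k → k ≤ n → ∫⁻ r, ((T r).meanQueryCost n k : ℝ≥0∞) ∂P ≤ tq)
    (htu : ∫⁻ r, ((T r).meanInsertionCost n : ℝ≥0∞) ∂P ≤ n * tu) {δ : ℝ} (hδ : 0 ≤ δ)
    (hq : (tq : ℝ) ≤ 1 + δ) : Tradeoff u m b n δ tu := by
  intro k₁ R g s φ ρ κ η hk₁ hg hs hk hφ hρ hb hκ hη
  have hκ0 : 0 ≤ κ := le_trans (by positivity) hκ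
  set e : ℕ → ℕ := fun i => k₁ + (i + 1) * (g * s) with he
  have hen : ∀ i ∈ Finset.range R, e i ≤ n := fun i hi => by
    have : (i + 1) * (g * s) ≤ R * (g * s) := Nat.mul_le_mul_right _ (Finset.mem_range.1 hi)
    simp only [he]; omega
  set A : ℝ := R * ((s : ℝ) * (1 - 4 * (φ + s * ρ) - η)) + κ * ∑ i ∈ Finset.range R, (e i : ℝ)
    with hA
  -- The right side of `rounds_cost_ge` is a sum of nonnegative terms, so it passes to `ℝ≥0∞` and
  -- can be integrated without any integrability condition.
  have hpt : ∀ r, ENNReal.ofReal A ≤ ((T r).meanInsertionCost n : ℝ≥0∞) +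
      (∑ i ∈ Finset.range R, ENNReal.ofReal (κ * e i) * ((T r).meanQueryCost n (e i) : ℝ≥0∞) +
        ENNReal.ofReal (R * (κ * (5 * m)))) := by
    intro r
    have h := (T r).rounds_cost_ge (hT r) hm hu hk₁ hg hs hk hφ hρ hb hκ hη
    refine (ENNReal.ofReal_le_ofReal h).trans (le_of_eq ?_)
    rw [ENNReal.ofReal_add (by positivity) (by positivity),
      ENNReal.ofReal_add (by positivity) (by positivity), ENNReal.ofReal_coe_nnreal, add_assoc,
      ENNReal.ofReal_sum_of_nonneg fun i _ => by positivity]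
    congr 2
    refine Finset.sum_congr rfl fun i _ => ?_
    rw [ENNReal.ofReal_mul (by positivity), ENNReal.ofReal_coe_nnreal]
  have hint : ENNReal.ofReal A ≤ (n * tu : ℝ≥0∞) +
      (∑ i ∈ Finset.range R, ENNReal.ofReal (κ * e i) * (tq : ℝ≥0∞) +
        ENNReal.ofReal (R * (κ * (5 * m)))) := by
    have hmq : ∀ i ∈ Finset.range R, Measurable fun r =>
        ENNReal.ofReal (κ * e i) * ((T r).meanQueryCost n (e i) : ℝ≥0∞) := fun i _ =>
      (HashTable.measurable_meanQueryCost hmeas (e i)).const_mul _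
    calc ENNReal.ofReal A = ∫⁻ _r, ENNReal.ofReal A ∂P := by simp
      _ ≤ _ := lintegral_mono hpt
      _ = _ := by
        rw [lintegral_add_right _ ((Finset.measurable_sum _ hmq).add_const _),
          lintegral_add_right _ measurable_const, lintegral_finsetSum _ hmq]
      _ ≤ _ := by
        refine add_le_add htu (add_le_add (Finset.sum_le_sum fun i hi => ?_) (by simp))
        rw [lintegral_const_mul _ (HashTable.measurable_meanQueryCost hmeas (e i))]
        gcongr
        exact htq _ (by simp only [he]; omega) (hen i hi)
  have hreal : A ≤ n * tu + (∑ i ∈ Finset.range R, κ * e i * tq + R * (κ * (5 * m))) := by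
    have h0 : 0 ≤ (n : ℝ) * tu + (∑ i ∈ Finset.range R, κ * e i * tq + R * (κ * (5 * m))) := by
      positivity
    rw [← ENNReal.ofReal_le_ofReal_iff h0]
    refine hint.trans (le_of_eq ?_)
    rw [ENNReal.ofReal_add (by positivity) (by positivity),
      ENNReal.ofReal_add (by positivity) (by positivity),
      ENNReal.ofReal_mul (Nat.cast_nonneg n), ENNReal.ofReal_natCast, ENNReal.ofReal_coe_nnreal,
      ENNReal.ofReal_sum_of_nonneg fun i _ => by positivity]
    congr 2
    refine Finset.sum_congr rfl fun i _ => ?_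
    rw [ENNReal.ofReal_mul (p := κ * e i) (by positivity), ENNReal.ofReal_coe_nnreal]
  have hsum : ∑ i ∈ Finset.range R, κ * e i * tq
      ≤ κ * ∑ i ∈ Finset.range R, (e i : ℝ) + R * (κ * (n * δ)) := by
    calc ∑ i ∈ Finset.range R, κ * e i * tq
        ≤ ∑ i ∈ Finset.range R, (κ * e i + κ * (n * δ)) := by
          refine Finset.sum_le_sum fun i hi => ?_
          have h1 : (e i : ℝ) ≤ n := by exact_mod_cast hen i hi
          calc κ * e i * tq ≤ κ * e i * (1 + δ) := by gcongr
            _ = κ * e i + κ * (e i * δ) := by ring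
            _ ≤ _ := by gcongr
      _ = _ := by
        rw [Finset.sum_add_distrib, ← Finset.mul_sum, Finset.sum_const, Finset.card_range,
          nsmul_eq_mul]
  rw [hA] at hreal
  linarith

/-! ### Choice of the parameters. -/

theorem pow_mul_exp_le {u m b : ℕ} (hub : u < 2 ^ b) (hm : 1 ≤ m) (hb : 1 ≤ b) {y z : ℝ}
    (hy : 3 * ((b : ℝ) * m) ≤ y) (hz : 3 * ((b : ℝ) * m) ≤ z) :
    (2 * u : ℝ) ^ m * (Real.exp (-y) + Real.exp (-z)) ≤ 2 * Real.exp (-(b : ℝ)) := by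
  have hb' : (1 : ℝ) ≤ b := by exact_mod_cast hb
  have hm' : (1 : ℝ) ≤ m := by exact_mod_cast hm
  -- There are thus at most e^(2bm) memory contents; tails e^(-3bm) absorb them and leave e^(-bm).
  have h1 : (2 * u : ℝ) ≤ Real.exp (2 * b) := by
    have h2 : (2 : ℝ) ≤ Real.exp 1 := by have := Real.add_one_le_exp (1 : ℝ); linarith
    have h3 : (u : ℝ) ≤ 2 ^ b := by exact_mod_cast hub.le
    calc (2 * u : ℝ) ≤ 2 * 2 ^ b := by gcongr
      _ = 2 ^ (b + 1) := by ring
      _ ≤ (Real.exp 1) ^ (b + 1) := by gcongr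
      _ = Real.exp (b + 1) := by rw [← Real.exp_nat_mul]; push_cast; ring_nf
      _ ≤ _ := Real.exp_le_exp.2 (by linarith)
  have h2 : (2 * u : ℝ) ^ m ≤ Real.exp (2 * (b * m)) := by
    calc (2 * u : ℝ) ^ m ≤ (Real.exp (2 * b)) ^ m := by gcongr
      _ = _ := by rw [← Real.exp_nat_mul]; ring_nf
  have h3 : Real.exp (-y) + Real.exp (-z) ≤ 2 * Real.exp (-(3 * (b * m))) := by
    have h4 : Real.exp (-y) ≤ Real.exp (-(3 * (b * m))) := Real.exp_le_exp.2 (by linarith)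
    have h5 : Real.exp (-z) ≤ Real.exp (-(3 * (b * m))) := Real.exp_le_exp.2 (by linarith)
    linarith
  calc _ ≤ Real.exp (2 * (b * m)) * (2 * Real.exp (-(3 * (b * m)))) := by gcongr
    _ = 2 * (Real.exp (2 * (b * m)) * Real.exp (-(3 * (b * m)))) := by ring
    _ = 2 * Real.exp (-(b * m)) := by rw [← Real.exp_add]; ring_nf
    _ ≤ _ := by
      have : (b : ℝ) ≤ b * m := le_mul_of_one_le_right (by linarith) hm'
      gcongr

theorem half_le_floor {y : ℝ} (hy : 1 ≤ y) : y / 2 ≤ (⌊y⌋₊ : ℝ) := by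
  have h1 := Nat.lt_floor_add_one y
  have h2 : (1 : ℝ) ≤ ⌊y⌋₊ := by exact_mod_cast (Nat.one_le_floor_iff y).2 hy
  linarith

/-- The number of insertions in the whole windows that fit between `k` and `n`. -/
theorem le_div_mul_add {n k s : ℕ} (hs : 0 < s) :
    (n : ℝ) - k - s ≤ ((n - k) / s : ℕ) * s := by
  have h1 := Nat.div_add_mod (n - k) s
  have h2 := Nat.mod_lt (n - k) hs
  have h3 : n ≤ k + ((n - k) / s * s + s) := by rw [mul_comm ((n - k) / s)]; omega
  have h4 : (n : ℝ) ≤ k + (((n - k) / s : ℕ) * s + s) := by exact_mod_cast h3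
  linarith

/-- The tradeoff for cheap queries. Here `X` stands for `b ^ c` and `φ` for `b ^ ((1 - c) / 4)`. -/
theorem Tradeoff.insertionCost_ge_sub {u m b n : ℕ} {K ε X φ tu : ℝ} (hK : 0 < K) (hε : 0 < ε)
    (htu : 0 ≤ tu) (H : Tradeoff u m b n (K / X) tu) (hub : u < 2 ^ b) (hm : 1 ≤ m) (hb : 1 ≤ b)
    (hφ : 0 < φ) (hφ1 : φ ≤ 1) (hX : 1 ≤ X) (hφX : φ ^ 4 * X = b)
    (hn : ε * (m * (b * X ^ 2)) ≤ n) (hεX : 48 ≤ ε * X) (hexp : 2 * Real.exp (-(b : ℝ)) ≤ φ) :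
    1 - (12 + 32 * (K + 5 / ε)) * φ ≤ tu := by
  have hb' : (1 : ℝ) ≤ b := by exact_mod_cast hb
  have hm' : (1 : ℝ) ≤ m := by exact_mod_cast hm
  have hX0 : 0 < X := by linarith
  have hb0 : (0 : ℝ) < b := by linarith
  -- the density of items per block, in terms of `X`
  have hnX : 48 * (b * m) ≤ n / X := by
    rw [le_div_iff₀ hX0]
    calc 48 * ((b : ℝ) * m) * X ≤ (ε * X) * (b * m) * X := by gcongr
      _ = ε * (m * (b * X ^ 2)) := by ring
      _ ≤ n := hn
  have hbm : (1 : ℝ) ≤ b * m := by nlinarith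
  have hn0 : (0 : ℝ) < n := by
    have : 0 < (n : ℝ) / X := by linarith
    exact (div_pos_iff_of_pos_right hX0).1 this
  have hφ4 : φ ^ 4 * n / b = n / X := by
    rw [← hφX]; field_simp
  have hmX : (m : ℝ) ≤ n / X / ε := by
    rw [le_div_iff₀ hε, le_div_iff₀ hX0]
    refine le_trans ?_ hn
    have h1 : X ≤ b * X ^ 2 := by nlinarith [mul_le_mul hb' hX (by norm_num) hb0.le]
    calc (m : ℝ) * ε * X = ε * (m * X) := by ring
      _ ≤ ε * (m * (b * X ^ 2)) := by gcongr
  -- The largest group size with sρ ≤ φ for the ρ used below. Since n/X = 8φy, the slow items are an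
  -- O(φ) fraction of it.
  set y : ℝ := φ ^ 3 * n / (8 * b) with hy
  have hyφ : φ * y = n / X / 8 := by
    rw [hy, ← hφ4]; field_simp
  have hy0 : 0 < y := by positivity
  have hy1 : 1 ≤ y := by
    have h1 : φ * y ≤ y := mul_le_of_le_one_left hy0.le hφ1
    linarith
  set s := ⌊y⌋₊ with hs
  have hs0 : 0 < s := Nat.floor_pos.2 hy1
  have hs0' : (0 : ℝ) < s := by exact_mod_cast hs0
  have hsy : (s : ℝ) ≤ y := Nat.floor_le hy0.le
  have hys : y / 2 ≤ s := half_le_floor hy1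
  have hyn : 8 * y ≤ φ * n := by
    rw [hy, ← mul_div_assoc, div_le_iff₀ (by positivity)]
    have h1 : φ ^ 3 ≤ φ := by
      calc φ ^ 3 = φ * φ ^ 2 := by ring
        _ ≤ φ * 1 := by gcongr; exact pow_le_one₀ hφ.le hφ1
        _ = φ := mul_one _
    calc 8 * (φ ^ 3 * n) ≤ 8 * (φ * n * b) := by
          refine mul_le_mul_of_nonneg_left ?_ (by norm_num)
          exact (mul_le_mul_of_nonneg_right h1 hn0.le).trans
            (le_mul_of_one_le_right (by positivity) hb')
      _ = φ * n * (8 * b) := by ring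
  set k₁ := ⌈φ * n⌉₊ with hk₁
  have hk₁n : k₁ ≤ n := Nat.ceil_le.2 (mul_le_of_le_one_left hn0.le hφ1)
  have hk₁φ : φ * n ≤ k₁ := Nat.le_ceil _
  have hk₁0 : 0 < k₁ := Nat.ceil_pos.2 (by positivity)
  have hk₁u : (k₁ : ℝ) ≤ 2 * (φ * n) := by
    have := Nat.ceil_lt_add_one (a := φ * n) (by positivity)
    rw [← hk₁] at this
    linarith
  set R := (n - k₁) / s with hR
  have hRs : (n : ℝ) - k₁ - s ≤ R * s := le_div_mul_add hs0
  have hρs : (s : ℝ) * (8 * b / (φ ^ 2 * n)) ≤ φ := by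
    calc (s : ℝ) * (8 * b / (φ ^ 2 * n)) ≤ y * (8 * b / (φ ^ 2 * n)) := by gcongr
      _ = φ := by rw [hy]; field_simp
  -- One group per window. This ρ makes b/ρ ≤ φk₁/8 hold when k₁ ≥ φn, and κ = 2 since both of its
  -- summands are at most 1.
  have hH := H k₁ R 1 s φ (8 * b / (φ ^ 2 * n)) 2 φ hk₁0 one_pos hs0
    (by
      have := Nat.div_mul_le_self (n - k₁) s
      rw [← hR] at this
      rw [one_mul]; omega)
    hφ (by positivity)
    (by
      calc (b : ℝ) / (8 * b / (φ ^ 2 * n)) = φ * (φ * n) / 8 := by field_simp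
        _ ≤ _ := by gcongr)
    (by
      have : 8 * (s : ℝ) / (φ * k₁) ≤ 1 := by
        calc 8 * (s : ℝ) / (φ * k₁) ≤ 8 * y / (φ * (φ * n)) := by gcongr
          _ = φ / b := by rw [hy]; field_simp
          _ ≤ 1 := (div_le_one hb0).2 (hφ1.trans hb')
      push_cast; linarith)
    (by
      refine (pow_mul_exp_le hub hm hb ?_ ?_).trans hexp
      · rw [one_mul]
        have : φ * (y / 2) ≤ φ * s := by gcongr
        linarith
      · have h1 : φ * (φ * n) ≤ φ * k₁ := by gcongr
        have h2 : φ * (8 * y) ≤ φ * (φ * n) := by gcongr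
        linarith)
  have hloss : 2 * (n * (K / X) + 5 * m) ≤ 32 * (K + 5 / ε) * φ * s := by
    calc 2 * (n * (K / X) + 5 * m) ≤ 2 * (n * (K / X) + 5 * (n / X / ε)) := by gcongr
      _ = 2 * (K + 5 / ε) * (n / X) := by field_simp
      _ = 2 * (K + 5 / ε) * (16 * (φ * (y / 2))) := by
            rw [show (n : ℝ) / X = 8 * (φ * y) by linarith]; ring
      _ ≤ 2 * (K + 5 / ε) * (16 * (φ * s)) := by gcongr
      _ = _ := by ring
  set a : ℝ := 9 + 32 * (K + 5 / ε) with ha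
  have ha0 : 0 < a := by positivity
  have hmain : (R * s) * (1 - a * φ) ≤ n * tu := by
    refine le_trans ?_ hH
    rw [mul_assoc]
    refine mul_le_mul_of_nonneg_left ?_ (Nat.cast_nonneg _)
    have h1 : (s : ℝ) * (1 - 9 * φ) ≤ s * (1 - 4 * (φ + s * (8 * b / (φ ^ 2 * n))) - φ) :=
      mul_le_mul_of_nonneg_left (by linarith) hs0'.le
    calc (s : ℝ) * (1 - a * φ) = s * (1 - 9 * φ) - 32 * (K + 5 / ε) * φ * s := by rw [ha]; ring
      _ ≤ _ := sub_le_sub h1 hloss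
  -- The skipped start `k₁` and an incomplete last window lose at most 3φn insertions, so that (1 -
  -- 3φ)(1 - aφ) gives the constant a + 3.
  rcases le_total (1 - a * φ) 0 with h | h
  · have : 0 ≤ 3 * φ := by positivity
    linarith
  · have h1 : (n : ℝ) * (1 - 3 * φ) ≤ R * s := by linarith
    have h2 : (n : ℝ) * ((1 - 3 * φ) * (1 - a * φ)) ≤ n * tu := by
      rw [← mul_assoc]
      exact (mul_le_mul_of_nonneg_right h1 h).trans hmain
    have h3 := le_of_mul_le_mul_left h2 hn0
    have h4 : 0 ≤ 3 * a * φ ^ 2 := by positivity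
    nlinarith

/-- The tradeoff for more expensive queries. Here `X` stands for `b ^ c` and `Z` for
`b ^ (1 - c)`. -/
theorem Tradeoff.insertionCost_ge_div {u m b n : ℕ} {K ε X Z tu : ℝ} (hK : 0 < K) (hε : 0 < ε)
    (H : Tradeoff u m b n (K / X) tu) (hub : u < 2 ^ b) (hm : 1 ≤ m) (hb : 15 ≤ b)
    (hX : 1 ≤ X) (hZ : 1 ≤ Z) (hZX : Z * X = b)
    (hn : ε * (m * (b * X ^ 2)) ≤ n) (hεX : 2 ^ 20 ≤ ε * X)
    (hKX : 2 ^ 14 * (K + 5 / ε + 1) ≤ X) :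
    1 / (2 ^ 24 * (K + 5 / ε + 1)) / Z ≤ tu := by
  have hb' : (15 : ℝ) ≤ b := by exact_mod_cast hb
  have hm' : (1 : ℝ) ≤ m := by exact_mod_cast hm
  have hX0 : 0 < X := by linarith
  have hZ0 : 0 < Z := by linarith
  have hb0 : (0 : ℝ) < b := by linarith
  set Q : ℝ := K + 5 / ε + 1 with hQ
  have hQ1 : 1 ≤ Q := by
    have : 0 ≤ K + 5 / ε := by positivity
    linarith
  have hQ0 : 0 < Q := by linarith
  have hnX : 2 ^ 20 * (b * m) ≤ n / X := by
    rw [le_div_iff₀ hX0]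
    calc 2 ^ 20 * ((b : ℝ) * m) * X ≤ (ε * X) * (b * m) * X := by gcongr
      _ = ε * (m * (b * X ^ 2)) := by ring
      _ ≤ n := hn
  have hbm : (b : ℝ) ≤ b * m := le_mul_of_one_le_right hb0.le hm'
  have hnX0 : 0 < (n : ℝ) / X := by linarith
  have hn0 : (0 : ℝ) < n := (div_pos_iff_of_pos_right hX0).1 hnX0
  have hnn : (n : ℝ) / X ≤ n := div_le_self hn0.le hX
  have hmX : (m : ℝ) ≤ n / X / ε := by
    rw [le_div_iff₀ hε, le_div_iff₀ hX0]
    refine le_trans ?_ hn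
    have h1 : X ≤ b * X ^ 2 := by
      calc X = 1 * (X * 1) := by ring
        _ ≤ b * (X * X) := by gcongr; linarith
        _ = b * X ^ 2 := by ring
    calc (m : ℝ) * ε * X = ε * (m * X) := by ring
      _ ≤ ε * (m * (b * X ^ 2)) := by gcongr
  have hnb : (n : ℝ) / b * Z = n / X := by
    rw [← hZX]; field_simp
  -- Chosen so that sρ ≤ 1/64 with ρ = 1024b/n.
  set y : ℝ := n / b / 2 ^ 16 with hy
  have hy0 : 0 < y := by positivity
  have hy1 : 1 ≤ y := by
    have h1 : 2 ^ 20 * ((b : ℝ) * m) * X ≤ n := (le_div_iff₀ hX0).1 hnX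
    rw [hy, le_div_iff₀ (by positivity), le_div_iff₀ hb0]
    have h2 : (b : ℝ) ≤ b * m * X := hbm.trans (le_mul_of_one_le_right (by positivity) hX)
    linarith
  set s := ⌊y⌋₊ with hs
  have hs0 : 0 < s := Nat.floor_pos.2 hy1
  have hs0' : (0 : ℝ) < s := by exact_mod_cast hs0
  have hsy : (s : ℝ) ≤ y := Nat.floor_le hy0.le
  have hys : y / 2 ≤ s := half_le_floor hy1
  -- Enough groups that gs is at least 4Qn/X, while the slow items number at most Qn/X in
  -- expectation.
  set g := ⌈2 ^ 19 * Q * Z⌉₊ with hg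
  have hQZ : 1 ≤ 2 ^ 19 * Q * Z := by
    have : 1 ≤ Q * Z := one_le_mul_of_one_le_of_one_le hQ1 hZ
    linarith
  have hg1 : 2 ^ 19 * Q * Z ≤ g := Nat.le_ceil _
  have hg0 : 0 < g := Nat.ceil_pos.2 (by linarith)
  have hg2 : (g : ℝ) ≤ 2 ^ 20 * Q * Z := by
    have := Nat.ceil_lt_add_one (a := 2 ^ 19 * Q * Z) (by linarith)
    rw [← hg] at this
    linarith
  have hg0' : (0 : ℝ) < g := by exact_mod_cast hg0
  set k₁ := ⌈(n : ℝ) / 2⌉₊ with hk₁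
  have hk₁n : k₁ ≤ n := Nat.ceil_le.2 (by linarith)
  have hk₁φ : (n : ℝ) / 2 ≤ k₁ := Nat.le_ceil _
  have hk₁0 : 0 < k₁ := Nat.ceil_pos.2 (by positivity)
  have hk₁u : (k₁ : ℝ) ≤ n / 2 + 1 := (Nat.ceil_lt_add_one (by positivity)).le
  set R := (n - k₁) / (g * s) with hR
  have hRs : (n : ℝ) - k₁ - ((g * s : ℕ) : ℝ) ≤ R * ((g * s : ℕ) : ℝ) :=
    le_div_mul_add (Nat.mul_pos hg0 hs0)
  have hgs1 : (g : ℝ) * s ≤ n / 8 := by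
    calc (g : ℝ) * s ≤ 2 ^ 20 * Q * Z * y := by gcongr
      _ = 2 ^ 4 * Q * (n / X) := by rw [hy, ← hnb]; ring
      _ = 2 ^ 14 * Q * n / X / 2 ^ 10 := by ring
      _ ≤ X * n / X / 2 ^ 10 := by gcongr
      _ = n / 2 ^ 10 := by field_simp
      _ ≤ n / 8 := by gcongr; norm_num
  have hgs2 : 4 * Q * (n / X) ≤ g * s := by
    calc 4 * Q * (n / X) = 2 ^ 19 * Q * Z * (y / 2) := by rw [hy, ← hnb]; ring
      _ ≤ g * s := by gcongr
  have hρs : (s : ℝ) * (1024 * b / n) ≤ 1 / 64 := by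
    calc (s : ℝ) * (1024 * b / n) ≤ y * (1024 * b / n) := by gcongr
      _ = 1 / 64 := by rw [hy]; field_simp; norm_num
  -- Here 1 - 4(1/64 + 1/64) - 1/8 = 3/4. The slow items cost at most 3s/8, so more than s/4 remains
  -- per window.
  have hH := H k₁ R g s (1 / 64) (1024 * b / n) (1 / (2 ^ 19 * Q * Z) + 1 / (64 * b)) (1 / 8)
    hk₁0 hg0 hs0
    (by
      have := Nat.div_mul_le_self (n - k₁) (g * s)
      rw [← hR] at this
      omega)
    (by norm_num) (by positivity)
    (by
      calc (b : ℝ) / (1024 * b / n) = 1 / 64 * (n / 2) / 8 := by field_simp; norm_num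
        _ ≤ _ := by gcongr)
    (by
      refine add_le_add (one_div_le_one_div_of_le (by positivity) hg1) ?_
      calc 8 * (s : ℝ) / (1 / 64 * k₁) ≤ 8 * y / (1 / 64 * (n / 2)) := by gcongr
        _ = 1 / (64 * b) := by rw [hy]; field_simp; norm_num)
    (by
      refine (pow_mul_exp_le hub hm (by omega) ?_ ?_).trans ?_
      · push_cast
        have : (n : ℝ) / X ≤ Q * (n / X) := le_mul_of_one_le_left hnX0.le hQ1
        linarith
      · linarith
      · have h1 : Real.exp (-(b : ℝ)) ≤ 1 / 16 := by
          rw [Real.exp_neg, one_div]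
          refine inv_anti₀ (by norm_num) ?_
          have := Real.add_one_le_exp (b : ℝ)
          linarith
        linarith)
  have hloss : (1 / (2 ^ 19 * Q * Z) + 1 / (64 * b)) * (n * (K / X) + 5 * m) ≤ s * (3 / 8) := by
    have h1 : n * (K / X) + 5 * m ≤ Q * (n / X) := by
      calc n * (K / X) + 5 * m ≤ n * (K / X) + 5 * (n / X / ε) := by gcongr
        _ = (K + 5 / ε) * (n / X) := by field_simp
        _ ≤ Q * (n / X) := by gcongr; linarith
    have h2 : 1 / (2 ^ 19 * Q * Z) * (Q * (n / X)) = y / 8 := by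
      rw [hy, ← hnb]; field_simp; norm_num
    have h3 : 1 / (64 * b) * (Q * (n / X)) ≤ y / 16 := by
      calc 1 / (64 * b) * (Q * (n / X)) = (2 ^ 14 * Q) * (n / b / X / 2 ^ 20) := by
            field_simp; norm_num
        _ ≤ X * (n / b / X / 2 ^ 20) := by gcongr
        _ = y / 16 := by rw [hy]; field_simp; norm_num
    calc _ ≤ (1 / (2 ^ 19 * Q * Z) + 1 / (64 * b)) * (Q * (n / X)) := by gcongr
      _ = 1 / (2 ^ 19 * Q * Z) * (Q * (n / X)) + 1 / (64 * b) * (Q * (n / X)) := by ring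
      _ ≤ _ := by linarith
  have hmain : (R : ℝ) * (s * (1 / 4)) ≤ n * tu := by
    refine le_trans (mul_le_mul_of_nonneg_left ?_ (Nat.cast_nonneg _)) hH
    have h1 : (s : ℝ) * (3 / 4) ≤ s * (1 - 4 * (1 / 64 + s * (1024 * b / n)) - 1 / 8) := by
      gcongr; linarith
    linarith
  have hRg : (n : ℝ) / 4 ≤ g * (R * s) := by
    push_cast at hRs
    linarith
  have hRs' : (n : ℝ) / 4 ≤ 2 ^ 20 * Q * Z * (R * s) :=
    hRg.trans (by gcongr)
  have hfin : (n : ℝ) * (1 / 2 ^ 24) ≤ n * (Q * Z * tu) := by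
    calc (n : ℝ) * (1 / 2 ^ 24) = n / 4 / 2 ^ 22 := by ring
      _ ≤ 2 ^ 20 * Q * Z * (R * s) / 2 ^ 22 := by gcongr
      _ = Q * Z * (R * (s * (1 / 4))) := by ring
      _ ≤ Q * Z * (n * tu) := by gcongr
      _ = _ := by ring
  have h1 := le_of_mul_le_mul_left hfin hn0
  rw [div_div, div_le_iff₀ (by positivity)]
  calc (1 : ℝ) = 2 ^ 24 * (1 / 2 ^ 24) := by norm_num
    _ ≤ 2 ^ 24 * (Q * Z * tu) := by gcongr
    _ = _ := by ring

end ExternalHash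

/-! ### The three regimes of the query cost. -/

open Filter in
theorem theorem1 (c K ε : ℝ) (hc : 0 < c) (hK : 0 < K) (hε : 0 < ε) :
    ∃ C : ℝ, 0 < C ∧ ∃ b₀ : ℕ, ∀ b m u n : ℕ, b₀ ≤ b → 1 ≤ m →
      u < 2 ^ b → n ^ 3 < u → ε * (m * (b : ℝ) ^ (1 + 2 * c)) ≤ n →
      -- a randomized hash table: `Ω` is the space of its random choices
      ∀ (Ω : Type*) [MeasurableSpace Ω] (P : Measure Ω) [IsProbabilityMeasure P]
        (T : Ω → ExternalHash.HashTable u m b),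
        (∀ r, (T r).AnswersQueries n) →
        (∀ x : Fin n → Fin u, Measurable fun r => (T r).insertionCost x) →
        (∀ (x : Fin n → Fin u) (k : ℕ) (y : Fin u),
          Measurable fun r => (T r).queryCost x k y) →
        ∀ tq tu : ℝ≥0,
          (∀ k : ℕ, 1 ≤ k → k ≤ n → ∫⁻ r, ((T r).meanQueryCost n k : ℝ≥0∞) ∂P ≤ tq) →
          ∫⁻ r, ((T r).meanInsertionCost n : ℝ≥0∞) ∂P ≤ n * tu →
          (tq : ℝ) ≤ 1 + K / (b : ℝ) ^ c →
          (1 < c → 1 - C / (b : ℝ) ^ ((c - 1) / 4) ≤ tu) ∧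
          (c = 1 → C ≤ tu) ∧
          (c < 1 → C * (b : ℝ) ^ (c - 1) ≤ tu) := by
  have hpow : Tendsto (fun b : ℕ => (b : ℝ) ^ c) atTop atTop :=
    (tendsto_rpow_atTop hc).comp tendsto_natCast_atTop_atTop
  have hεpow : Tendsto (fun b : ℕ => ε * (b : ℝ) ^ c) atTop atTop := hpow.const_mul_atTop hε
  -- Allows η = φ when c > 1.
  have hexp : ∀ᶠ b : ℕ in atTop,
      2 * Real.exp (-(b : ℝ)) ≤ (b : ℝ) ^ (-((c - 1) / 4)) := by
    have h := (tendsto_rpow_mul_exp_neg_mul_atTop_nhds_zero ((c - 1) / 4) 1 one_pos).comp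
      tendsto_natCast_atTop_atTop
    filter_upwards [h.eventually (gt_mem_nhds (show (0 : ℝ) < 1 / 2 by norm_num)),
      eventually_ge_atTop 1] with b hb hb1
    have hb0 : (0 : ℝ) < b := by exact_mod_cast hb1
    have hb' : (b : ℝ) ^ ((c - 1) / 4) * Real.exp (-(b : ℝ)) < 1 / 2 := by
      simpa [Function.comp] using hb
    have hp : 0 < (b : ℝ) ^ ((c - 1) / 4) := Real.rpow_pos_of_pos hb0 _
    rw [Real.rpow_neg hb0.le, ← one_div, le_div_iff₀ hp]
    linarith
  have hev : ∀ᶠ b : ℕ in atTop, 15 ≤ b ∧ 2 ^ 20 ≤ ε * (b : ℝ) ^ c ∧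
      2 ^ 14 * (K + 5 / ε + 1) ≤ (b : ℝ) ^ c ∧
      2 * Real.exp (-(b : ℝ)) ≤ (b : ℝ) ^ (-((c - 1) / 4)) :=
    (eventually_ge_atTop 15).and ((hεpow.eventually_ge_atTop _).and
      ((hpow.eventually_ge_atTop _).and hexp))
  obtain ⟨b₀, hb₀⟩ := eventually_atTop.1 hev
  have hQ : 0 < K + 5 / ε + 1 := by positivity
  have hmain : ∀ b m u n : ℕ, b₀ ≤ b → 1 ≤ m → u < 2 ^ b → n ^ 3 < u →
      ε * (m * (b : ℝ) ^ (1 + 2 * c)) ≤ n → ∀ tu : ℝ≥0,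
      ExternalHash.Tradeoff u m b n (K / (b : ℝ) ^ c) tu →
      (1 < c → 1 - (12 + 32 * (K + 5 / ε)) / (b : ℝ) ^ ((c - 1) / 4) ≤ tu) ∧
      (c ≤ 1 → 1 / (2 ^ 24 * (K + 5 / ε + 1)) * (b : ℝ) ^ (c - 1) ≤ tu) := by
    intro b m u n hb hm hub hu hn tu H
    obtain ⟨hb15, hεX, hKX, hexpb⟩ := hb₀ b hb
    have hb0 : (0 : ℝ) < b := by exact_mod_cast (by omega : 0 < b)
    have hb1 : (1 : ℝ) ≤ b := by exact_mod_cast (by omega : 1 ≤ b)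
    have hX1 : 1 ≤ (b : ℝ) ^ c := Real.one_le_rpow hb1 hc.le
    have hbX : (b : ℝ) ^ (1 + 2 * c) = b * ((b : ℝ) ^ c) ^ 2 := by
      rw [Real.rpow_add hb0, Real.rpow_one, ← Real.rpow_natCast, ← Real.rpow_mul hb0.le]
      push_cast
      ring_nf
    rw [hbX] at hn
    constructor
    · intro hc1
      -- The exponent solves φ^4 · b^c = b.
      have h := H.insertionCost_ge_sub (φ := (b : ℝ) ^ (-((c - 1) / 4))) hK hε tu.coe_nonneg hub hm
        (by omega) (Real.rpow_pos_of_pos hb0 _)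
        (Real.rpow_le_one_of_one_le_of_nonpos hb1 (by linarith)) hX1
        (by
          rw [← Real.rpow_natCast, ← Real.rpow_mul hb0.le, ← Real.rpow_add hb0]
          push_cast
          rw [show -((c - 1) / 4) * 4 + c = 1 by ring, Real.rpow_one])
        hn (by linarith) hexpb
      rwa [Real.rpow_neg hb0.le, ← div_eq_mul_inv] at h
    · intro hc1
      have h := H.insertionCost_ge_div (Z := (b : ℝ) ^ (1 - c)) hK hε hub hm hb15 hX1
        (Real.one_le_rpow hb1 (by linarith))
        (by rw [← Real.rpow_add hb0, sub_add_cancel, Real.rpow_one]) hn hεX hKX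
      rwa [div_eq_mul_inv _ ((b : ℝ) ^ (1 - c)), ← Real.rpow_neg hb0.le, neg_sub] at h
  have htrade : ∀ b m u n : ℕ, 1 ≤ m → n ^ 3 < u →
      ∀ (Ω : Type _) [MeasurableSpace Ω] (P : Measure Ω) [IsProbabilityMeasure P]
        (T : Ω → ExternalHash.HashTable u m b),
        (∀ r, (T r).AnswersQueries n) →
        (∀ (x : Fin n → Fin u) (k : ℕ) (y : Fin u),
          Measurable fun r => (T r).queryCost x k y) →
        ∀ tq tu : ℝ≥0,
          (∀ k : ℕ, 1 ≤ k → k ≤ n → ∫⁻ r, ((T r).meanQueryCost n k : ℝ≥0∞) ∂P ≤ tq) →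
          ∫⁻ r, ((T r).meanInsertionCost n : ℝ≥0∞) ∂P ≤ n * tu →
          (tq : ℝ) ≤ 1 + K / (b : ℝ) ^ c →
          ExternalHash.Tradeoff u m b n (K / (b : ℝ) ^ c) tu := by
    intro b m u n hm hu Ω _ P _ T hT hmeas tq tu htq htu hq
    have : NeZero u := ⟨by omega⟩
    have hnu : n ^ 2 ≤ u := by
      rcases Nat.eq_zero_or_pos n with rfl | h
      · simp
      · exact (Nat.pow_le_pow_right h (by norm_num)).trans hu.le
    exact ExternalHash.tradeoff_of_hashTable hm hnu P T hT hmeas htq htu (by positivity) hq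
  -- The cases c = 1 and c < 1 share one bound, as b^(c-1) = 1 for c = 1.
  rcases lt_or_ge 1 c with hc1 | hc1
  · refine ⟨12 + 32 * (K + 5 / ε), by positivity, b₀, ?_⟩
    intro b m u n hb hm hub hu hn Ω _ P _ T hT _ hmeas tq tu htq htu hq
    have h := hmain b m u n hb hm hub hu hn tu
      (htrade b m u n hm hu Ω P T hT hmeas tq tu htq htu hq)
    exact ⟨h.1, fun h1 => absurd h1 hc1.ne', fun h1 => absurd h1 hc1.not_gt⟩
  · refine ⟨1 / (2 ^ 24 * (K + 5 / ε + 1)), by positivity, b₀, ?_⟩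
    intro b m u n hb hm hub hu hn Ω _ P _ T hT _ hmeas tq tu htq htu hq
    have h := (hmain b m u n hb hm hub hu hn tu
      (htrade b m u n hm hu Ω P T hT hmeas tq tu htq htu hq)).2 hc1
    exact ⟨fun h1 => absurd h1 hc1.not_gt, fun h1 => by simpa [h1] using h, fun _ => h⟩
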